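/- **Conventions.** Let $d\ge 1$. Write $|E|$ for the Lebesgue measure of $E\subset\mathbb R^d$. The variation of an integrable $u\colon\mathbb R^d\to\mathbb R$ is $\mathbf V u=\sup\{\int u\,\operatorname{div}v : v\in C^1_c(\mathbb R^d;\mathbb R^d),\ |v|\le 1\}$. A $BV$-set is a bounded measurable set $B$ whose perimeter $\|B\|=\mathbf V\mathbf 1_B$ is finite. A charge on $[0,1]^d$ is a function $\omega$ from the $BV$-subsets of $[0,1]^d$ to $\mathbb R$ such that $\omega(B_1\cup B_2)=\omega(B_1)+\omega(B_2)$ whenever $|B_1\cap B_2|=0$, and $\omega(B_n)\to\omega(B)$ whenever $|B_n\triangle B|\to0$ and $\sup_n\|B_n\|<\infty$. Let $BV([0,1]^d)$ be the space of integrable $u$ on $\mathbb R^d$ with $\mathbf V u<\infty$ that vanish a.e. outside $[0,1]^d$, normed by $\mathbf V$. Let $SCH$ be the closure, in the dual $BV([0,1]^d)^*$, of the set of functionals $u\mapsto\int_{[0,1]^d} gu$ with $g\in L^d([0,1]^d)$. A charge is strong if it has the form $\omega(B)=\alpha(\mathbf 1_B)$ for some $\alpha\in SCH$; then $\|\omega\|$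 denotes the dual norm of $\alpha$, and $\operatorname{sch}([0,1]^d)$ is the normed space of strong charges. A dyadic cube of generation $n\ge 0$ is $K_{n,k}=\prod_{i=1}^d[2^{-n}k_i,2^{-n}(k_i+1)]$ with $k\in\{0,\dots,2^n-1\}^d$. For $\gamma\in(0,1)$, $\operatorname{sch}^\gamma([0,1]^d)$ is the space of charges $\omega$ on $[0,1]^d$ with $\|\omega\|_\gamma=\sup_K|\omega(K)|/|K|^\gamma<\infty$, where $K$ runs over all dyadic cubes. For an integrable $g$, $g\,d\mathscr L$ denotes the charge $B\mapsto\int_B g$; it belongs to $\operatorname{sch}^\gamma([0,1]^d)$ if $g\in L^{1/(1-\gamma)}([0,1]^d)$. For $\beta\in(0,1)$, $C^\beta([0,1]^d)$ is the space of $f\colon[0,1]^d\to\mathbb R$ with $\operatorname{Lip}^\beta(f)=\sup_{x\ne y}|f(x)-f(y)|/|x-y|^\beta<\infty$ (Euclidean norm). For $n\ge0$, $k\in\{0,\dots,2^n-1\}^d$ and $r\in\{0,1\}^d\setminus\{0\}$, the Haar functions and the Faber–Schauder coefficients of a charge $\omega$ are $$g_{n,k,r}=2^{nd/2}\sum_{\ell\in\{0,1\}^d}(-1)^{r\cdot\ell}\,\mathbf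 1_{K_{n+1,2k+\ell}},\qquad a_{n,k,r}(\omega)=2^{nd/2}\sum_{\ell\in\{0,1\}^d}(-1)^{r\cdot\ell}\,\omega(K_{n+1,2k+\ell}).$$ **Theorem (Young integral).** Let $d\ge1$ and $\beta,\gamma\in(0,1)$ with $\beta+d\gamma>d$. There is a unique bilinear map $(f,\omega)\mapsto\int_{[0,1]^d}f\,\omega$ from $C^\beta([0,1]^d)\times\operatorname{sch}^\gamma([0,1]^d)$ to $\mathbb R$ with the following two properties. (A) For all $f\in C^\beta([0,1]^d)$ and $g\in L^{1/(1-\gamma)}([0,1]^d)$, $\int_{[0,1]^d}f\,(g\,d\mathscr L)=\int_{[0,1]^d}fg$. (B) Let $(f_p)$ be a sequence in $C^\beta([0,1]^d)$ that converges uniformly to a function $f$, with $\sup_p\operatorname{Lip}^\beta(f_p)<\infty$, and let $(\omega_p)$ be a sequence in $\operatorname{sch}^\gamma([0,1]^d)$ with $\sup_p\|\omega_p\|_\gamma<\infty$ such that $\|\omega_p-\omega\|\to0$ for some $\omega\in\operatorname{sch}([0,1]^d)$. Then $f\in C^\beta([0,1]^d)$, $\omega\in\operatorname{sch}^\gamma([0,1]^d)$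 and $\int_{[0,1]^d}f_p\,\omega_p\to\int_{[0,1]^d}f\,\omega$. Furthermore, for all $f\in C^\beta([0,1]^d)$ and $\omega\in\operatorname{sch}^\gamma([0,1]^d)$, $$\int_{[0,1]^d}f\,\omega=\omega([0,1]^d)\int_{[0,1]^d}f+\sum_{n=0}^\infty\Big(\sum_{k}\sum_{r\ne0}a_{n,k,r}(\omega)\int_{[0,1]^d}f\,g_{n,k,r}\Big),$$ where the series over $n$ converges absolutely, and there is a constant $C\ge0$, depending only on $d,\beta,\gamma$, such that $$\Big|\int_{[0,1]^d}f\,\omega\Big|\le C\,\big(\|f\|_\infty+\operatorname{Lip}^\beta(f)\big)\,\|\omega\|_\gamma .$$ -/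

import Mathlib

open MeasureTheory Filter Topology Set
open scoped ENNReal NNReal

noncomputable section

namespace YoungCharge

/-! ### Functions of bounded variation and `BV`-sets -/

/-- The space `ℝ^d` with its Euclidean norm. -/
abbrev E (d : ℕ) : Type := EuclideanSpace ℝ (Fin d)

/-- The divergence of a vector field on `ℝ^d`. -/
def divergence {d : ℕ} (v : E d → E d) (x : E d) : ℝ :=
  ∑ i, (fderiv ℝ v x (EuclideanSpace.single i 1)) i

/-- The vector fields that are admissible in the definition of the variation: those of class
`C^1`, with compact support, and of Euclidean norm at most one everywhere. -/
def IsTestField {d : ℕ} (v : E d → E d) : Prop :=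
  ContDiff ℝ 1 v ∧ HasCompactSupport v ∧ ∀ x, ‖v x‖ ≤ 1

/-- The total variation over `ℝ^d` of an integrable function, possibly infinite. The zero field is
a test field, so cutting the integrals at `0` does not change the supremum. -/
def variation {d : ℕ} (u : E d → ℝ) : ℝ≥0∞ :=
  ⨆ (v : E d → E d) (_ : IsTestField v), ENNReal.ofReal (∫ x, u x * divergence v x)

/-- The perimeter of a set: the variation of its indicator function. -/
def perimeter {d : ℕ} (B : Set (E d)) : ℝ≥0∞ := variation (B.indicator fun _ => (1 : ℝ))

/-- A `BV`-set is a bounded, (Lebesgue) measurable set of finite perimeter. -/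
structure IsBVSet {d : ℕ} (B : Set (E d)) : Prop where
  bounded : Bornology.IsBounded B
  measurable : NullMeasurableSet B volume
  perimeter_lt_top : perimeter B < ∞

/-- The collection of the `BV`-subsets of `A`. -/
abbrev BVSubset {d : ℕ} (A : Set (E d)) : Type := {B : Set (E d) // B ⊆ A ∧ IsBVSet B}

/-- `BV`-convergence of a sequence of `BV`-subsets of `A`. -/
def BVConverges {d : ℕ} {A : Set (E d)} (B : ℕ → BVSubset A) (B' : BVSubset A) : Prop :=
  Tendsto (fun n => volume (symmDiff (B n).1 B'.1)) atTop (𝓝 0) ∧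
    (⨆ n, perimeter (B n).1) < ∞

/-! ### Charges -/

/-- Charges over `A`: functions on the `BV`-subsets of `A` that are additive on almost disjoint
pairs and sequentially continuous for `BV`-convergence. -/
structure IsCharge {d : ℕ} {A : Set (E d)} (ω : BVSubset A → ℝ) : Prop where
  additive : ∀ B₁ B₂ B : BVSubset A, volume (B₁.1 ∩ B₂.1) = 0 → B.1 = B₁.1 ∪ B₂.1 →
    ω B = ω B₁ + ω B₂
  continuous : ∀ (B : ℕ → BVSubset A) (B' : BVSubset A), BVConverges B B' →
    Tendsto (fun n => ω (B n)) atTop (𝓝 (ω B'))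

/-- The linear space of charges over `A`. -/
def charge {d : ℕ} (A : Set (E d)) : Submodule ℝ (BVSubset A → ℝ) where
  carrier := {ω | IsCharge ω}
  zero_mem' := ⟨fun _ _ _ _ _ => by simp, fun _ _ _ => by simp⟩
  add_mem' := by
    rintro a b ha hb
    refine ⟨fun B₁ B₂ B h h' => ?_, fun B B' h => ?_⟩
    · simp only [Pi.add_apply, ha.additive _ _ _ h h', hb.additive _ _ _ h h']
      ring
    · exact (ha.continuous B B' h).add (hb.continuous B B' h)
  smul_mem' := by
    rintro c a ha
    refine ⟨fun B₁ B₂ B h h' => ?_, fun B B' h => ?_⟩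
    · simp only [Pi.smul_apply, ha.additive _ _ _ h h', smul_eq_mul]
      ring
    · exact (ha.continuous B B' h).const_smul c

/-! ### The space `BV(A)` and strong charges -/

lemma divergence_neg {d : ℕ} (v : E d → E d) (x : E d) :
    divergence (-v) x = - divergence v x := by
  simp [divergence, fderiv_neg]

lemma IsTestField.neg {d : ℕ} {v : E d → E d} (hv : IsTestField v) : IsTestField (-v) := by
  refine ⟨hv.1.neg, ?_, fun x => by simpa using hv.2.2 x⟩
  exact hv.2.1.comp_left (g := fun y : E d => -y) (by simp)

lemma IsTestField.zero {d : ℕ} : IsTestField (0 : E d → E d) :=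
  ⟨contDiff_const, HasCompactSupport.zero, fun x => by simp⟩

lemma IsTestField.integrable_mul {d : ℕ} {v : E d → E d} (hv : IsTestField v) {u : E d → ℝ}
    (hu : Integrable u) : Integrable (fun x => u x * divergence v x) := by
  have hc : Continuous (divergence v) := by
    unfold divergence
    have := hv.1.continuous_fderiv (by simp)
    fun_prop
  have hs : HasCompactSupport (divergence v) := by
    refine (hv.2.1.fderiv (𝕜 := ℝ)).mono ?_
    intro x hx h
    apply hx
    simp [divergence, h]
  obtain ⟨C, hC⟩ := hs.exists_bound_of_continuous hc
  exact hu.mul_bdd (c := C) hc.aestronglyMeasurable (ae_of_all _ hC)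

lemma IsTestField.ofReal_le {d : ℕ} {v : E d → E d} (hv : IsTestField v) (u : E d → ℝ) :
    ENNReal.ofReal (∫ x, u x * divergence v x) ≤ variation u :=
  le_iSup₂ (f := fun (v : E d → E d) (_ : IsTestField v) =>
    ENNReal.ofReal (∫ x, u x * divergence v x)) v hv

lemma variation_zero {d : ℕ} : variation (0 : E d → ℝ) = 0 := by
  simp [variation]

lemma variation_add_le {d : ℕ} {u w : E d → ℝ} (hu : Integrable u) (hw : Integrable w) :
    variation (u + w) ≤ variation u + variation w := by
  refine iSup₂_le fun v hv => ?_
  have : ∫ x, (u + w) x * divergence v x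
      = (∫ x, u x * divergence v x) + ∫ x, w x * divergence v x := by
    rw [← integral_add (hv.integrable_mul hu) (hv.integrable_mul hw)]
    simp [add_mul]
  rw [this]
  exact ENNReal.ofReal_add_le.trans (add_le_add (hv.ofReal_le u) (hv.ofReal_le w))

lemma variation_smul_le {d : ℕ} (c : ℝ) (u : E d → ℝ) :
    variation (c • u) ≤ ENNReal.ofReal |c| * variation u := by
  refine iSup₂_le fun v hv => ?_
  have : ∫ x, (c • u) x * divergence v x = c * ∫ x, u x * divergence v x := by
    rw [← integral_const_mul]
    simp [mul_assoc]
  rw [this]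
  rcases le_total 0 c with hc | hc
  · rw [abs_of_nonneg hc, ENNReal.ofReal_mul hc]
    gcongr
    exact hv.ofReal_le u
  · have h2 : c * ∫ x, u x * divergence v x = |c| * ∫ x, u x * divergence (-v) x := by
      simp_rw [divergence_neg, mul_neg, integral_neg, abs_of_nonpos hc]
      ring
    rw [h2, ENNReal.ofReal_mul (abs_nonneg c)]
    gcongr
    exact hv.neg.ofReal_le u

/-- The integrable functions on `ℝ^d` of bounded variation that vanish almost everywhere
outside `A`. -/
def bvSubmodule {d : ℕ} (A : Set (E d)) : Submodule ℝ (E d → ℝ) where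
  carrier := {u | Integrable u ∧ variation u < ∞ ∧ ∀ᵐ x, x ∉ A → u x = 0}
  zero_mem' := ⟨integrable_zero _ _ _, by simp [variation_zero], by simp⟩
  add_mem' := by
    rintro a b ⟨ha, ha', ha''⟩ ⟨hb, hb', hb''⟩
    refine ⟨ha.add hb, (variation_add_le ha hb).trans_lt (ENNReal.add_lt_top.2 ⟨ha', hb'⟩), ?_⟩
    filter_upwards [ha'', hb''] with x h h' hx
    simp [h hx, h' hx]
  smul_mem' := by
    rintro c a ⟨ha, ha', ha''⟩
    refine ⟨ha.smul c, (variation_smul_le c a).trans_lt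
      (ENNReal.mul_lt_top ENNReal.ofReal_lt_top ha'), ?_⟩
    filter_upwards [ha''] with x h hx
    simp [h hx]

/-- The space `BV(A)`, normed by the variation. Its elements are kept as functions: functions
that agree almost everywhere are at distance zero, so that continuous linear functionals do not
distinguish them, and the dual space is that of the space of classes. -/
def BV {d : ℕ} (A : Set (E d)) : Type := bvSubmodule A

instance {d : ℕ} (A : Set (E d)) : AddCommGroup (BV A) :=
  inferInstanceAs (AddCommGroup (bvSubmodule A))

instance {d : ℕ} (A : Set (E d)) : Module ℝ (BV A) :=
  inferInstanceAs (Module ℝ (bvSubmodule A))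

/-- The function underlying an element of `BV(A)`. -/
def BV.toFun {d : ℕ} {A : Set (E d)} : BV A →ₗ[ℝ] (E d → ℝ) := (bvSubmodule A).subtype

lemma BV.mem {d : ℕ} {A : Set (E d)} (u : BV A) : u.toFun ∈ bvSubmodule A := Subtype.property u

/-- The variation, as a seminorm on `BV(A)`. -/
def bvSeminorm {d : ℕ} (A : Set (E d)) : Seminorm ℝ (BV A) :=
  Seminorm.ofSMulLE (fun u => (variation u.toFun).toReal)
    (by simp [variation_zero])
    (fun u w => by
      have hu := u.mem
      have hw := w.mem
      rw [map_add, ← ENNReal.toReal_add hu.2.1.ne hw.2.1.ne]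
      exact ENNReal.toReal_mono (ENNReal.add_lt_top.2 ⟨hu.2.1, hw.2.1⟩).ne
        (variation_add_le hu.1 hw.1))
    (fun c u => by
      have h := ENNReal.toReal_mono (ENNReal.mul_lt_top ENNReal.ofReal_lt_top u.mem.2.1).ne
        (variation_smul_le c u.toFun)
      rw [ENNReal.toReal_mul, ENNReal.toReal_ofReal (abs_nonneg c)] at h
      rw [map_smul]
      exact h)

instance {d : ℕ} (A : Set (E d)) : SeminormedAddCommGroup (BV A) :=
  (bvSeminorm A).toAddGroupSeminorm.toSeminormedAddCommGroup

instance {d : ℕ} (A : Set (E d)) : NormedSpace ℝ (BV A) where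
  norm_smul_le c u := (map_smul_eq_mul (bvSeminorm A) c u).le

lemma BV.norm_def {d : ℕ} {A : Set (E d)} (u : BV A) : ‖u‖ = (variation u.toFun).toReal := rfl

lemma BVSubset.indicator_mem {d : ℕ} {A : Set (E d)} (B : BVSubset A) :
    (B.1.indicator fun _ => (1 : ℝ)) ∈ bvSubmodule A := by
  refine ⟨?_, B.2.2.perimeter_lt_top, ae_of_all _ fun x hx => ?_⟩
  · exact (integrableOn_const B.2.2.bounded.measure_lt_top.ne).integrable_indicator₀
      B.2.2.measurable
  · exact indicator_of_notMem (fun h => hx (B.2.1 h)) _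

/-- The indicator function of a `BV`-subset of `A`, as an element of `BV(A)`. -/
def BVSubset.ind {d : ℕ} {A : Set (E d)} (B : BVSubset A) : BV A := ⟨_, BVSubset.indicator_mem B⟩

lemma BVSubset.toFun_ind {d : ℕ} {A : Set (E d)} (B : BVSubset A) :
    (BVSubset.ind B).toFun = B.1.indicator fun _ => (1 : ℝ) := rfl

/-- The strong charge functionals over `A`: the closure, in the dual of `BV(A)` with its operator
norm, of the functionals `u ↦ ∫_A g u` with `g` in `L^d(A)`. -/
def strongFunctional {d : ℕ} (A : Set (E d)) : Set (StrongDual ℝ (BV A)) :=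
  closure {α | ∃ g : E d → ℝ, MemLp g d (volume.restrict A) ∧
    ∀ u : BV A, α u = ∫ x in A, g x * u.toFun x}

/-- `α` is a strong charge functional and `ω` is the associated set function `B ↦ α(1_B)`. -/
def Represents {d : ℕ} {A : Set (E d)} (α : StrongDual ℝ (BV A)) (ω : BVSubset A → ℝ) : Prop :=
  α ∈ strongFunctional A ∧ ∀ B, ω B = α (BVSubset.ind B)

/-- A charge is strong if it comes from a strong charge functional. -/
def IsStrong {d : ℕ} {A : Set (E d)} (ω : charge A) : Prop :=
  ∃ α : StrongDual ℝ (BV A), Represents α ω.1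

/-- The norm of a strong charge, which is the operator norm of the functional that represents it
(and `∞` if the charge is not strong). -/
def strongNorm {d : ℕ} {A : Set (E d)} (ω : charge A) : ℝ≥0∞ :=
  ⨅ (α : StrongDual ℝ (BV A)) (_ : Represents α ω.1), ‖α‖ₑ

/-! ### The unit cube and its dyadic subcubes -/

/-- The unit cube `[0, 1]^d`. -/
def unitCube (d : ℕ) : Set (E d) := {x | ∀ i, x i ∈ Icc (0 : ℝ) 1}

/-- The dyadic cube `∏ [2^{-n} k_i, 2^{-n} (k_i + 1)]` of generation `n`. -/
def dyadicCube {d : ℕ} (n : ℕ) (k : Fin d → Fin (2 ^ n)) : Set (E d) :=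
  {x | ∀ i, x i ∈ Icc ((k i : ℝ) / 2 ^ n) (((k i : ℝ) + 1) / 2 ^ n)}

/-- The closed box with lower corner `a` and upper corner `b`. -/
def box {d : ℕ} (a b : Fin d → ℝ) : Set (E d) := {x | ∀ i, x i ∈ Icc (a i) (b i)}

lemma box_eq_preimage {d : ℕ} (a b : Fin d → ℝ) :
    box a b = WithLp.ofLp ⁻¹' (Icc a b) := by
  ext x
  simp [box, Pi.le_def, forall_and]

lemma measurableSet_box {d : ℕ} (a b : Fin d → ℝ) : MeasurableSet (box a b) := by
  rw [box_eq_preimage]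
  exact (PiLp.volume_preserving_ofLp (Fin d)).measurable measurableSet_Icc

lemma volume_box {d : ℕ} (a b : Fin d → ℝ) :
    volume (box a b) = ∏ i, ENNReal.ofReal (b i - a i) := by
  rw [box_eq_preimage, (PiLp.volume_preserving_ofLp (Fin d)).measure_preimage
    measurableSet_Icc.nullMeasurableSet, Real.volume_Icc_pi]

lemma isBounded_box {d : ℕ} (a b : Fin d → ℝ) : Bornology.IsBounded (box a b) := by
  have h : IsCompact (box a b) := by
    rw [box_eq_preimage]
    exact (PiLp.homeomorph 2 (fun _ : Fin d => ℝ)).isCompact_preimage.2 isCompact_Icc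
  exact h.isBounded

lemma perimeter_box_lt_top {d : ℕ} (a b : Fin d → ℝ) (hab : a ≤ b) :
    perimeter (box a b) < ∞ := by
  rcases d with _ | n
  · have : perimeter (box a b) = 0 := by simp [perimeter, variation, divergence]
    simp [this]
  set M : ℝ := ∑ i : Fin (n + 1),
    2 * (volume (Icc (a ∘ i.succAbove) (b ∘ i.succAbove))).toReal with hM
  suffices h : perimeter (box a b) ≤ ENNReal.ofReal M from h.trans_lt ENNReal.ofReal_lt_top
  refine iSup₂_le fun v hv => ENNReal.ofReal_le_ofReal ?_
  let eL : E (n + 1) ≃L[ℝ] (Fin (n + 1) → ℝ) := PiLp.continuousLinearEquiv 2 ℝ _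
  have hvd : Differentiable ℝ v := hv.1.differentiable (by simp)
  have hvi : ∀ (i : Fin (n + 1)) x, |v x i| ≤ 1 := fun i x =>
    (PiLp.norm_apply_le (v x) i).trans (hv.2.2 x)
  have h1 : ∫ x, (box a b).indicator (fun _ => (1 : ℝ)) x * divergence v x
      = ∫ y in Icc a b, divergence v (eL.symm y) := by
    have h2 : (fun x => (box a b).indicator (fun _ => (1 : ℝ)) x * divergence v x)
        = (box a b).indicator (divergence v) := by
      ext x
      by_cases hx : x ∈ box a b <;> simp [hx]
    rw [h2, integral_indicator (measurableSet_box a b), box_eq_preimage,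
      ← (PiLp.volume_preserving_ofLp (Fin (n + 1))).setIntegral_preimage_emb
        (MeasurableEquiv.toLp 2 (Fin (n + 1) → ℝ)).symm.measurableEmbedding]
    rfl
  have hcont : Continuous (divergence v) := by
    unfold divergence
    have := hv.1.continuous_fderiv (by simp)
    fun_prop
  have hproj : ∀ (i : Fin (n + 1)) (z : E (n + 1)), HasFDerivAt (fun z : E (n + 1) => z i)
      (EuclideanSpace.proj i : E (n + 1) →L[ℝ] ℝ) z := fun i z =>
    (EuclideanSpace.proj i : E (n + 1) →L[ℝ] ℝ).hasFDerivAt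
  have h3 := integral_divergence_of_hasFDerivAt_off_countable' a b hab
    (fun i y => v (eL.symm y) i)
    (fun i y => (EuclideanSpace.proj i).comp ((fderiv ℝ v (eL.symm y)).comp
      (eL.symm : (Fin (n + 1) → ℝ) →L[ℝ] E (n + 1)))) ∅ countable_empty
    (fun i => by
      have := hv.1.continuous
      fun_prop)
    (fun y _ i => (hproj i _).comp y
      ((hvd _).hasFDerivAt.comp y eL.symm.hasFDerivAt))
    (by
      have h4 : Continuous fun y => divergence v (eL.symm y) := hcont.comp eL.symm.continuous
      refine (h4.continuousOn.integrableOn_compact isCompact_Icc).congr_fun (fun y _ => ?_)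
        measurableSet_Icc
      simp [divergence, eL])
  have h5 : ∫ y in Icc a b, divergence v (eL.symm y) = ∫ y in Icc a b, ∑ i : Fin (n + 1),
      ((EuclideanSpace.proj i).comp ((fderiv ℝ v (eL.symm y)).comp
      (eL.symm : (Fin (n + 1) → ℝ) →L[ℝ] E (n + 1)))) (Pi.single i 1) := by
    refine setIntegral_congr_fun measurableSet_Icc fun y _ => ?_
    simp [divergence, eL]
  rw [h1, h5, h3, hM]
  refine Finset.sum_le_sum fun i _ => ?_
  have hfin : volume (Icc (a ∘ i.succAbove) (b ∘ i.succAbove)) < ∞ :=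
    isCompact_Icc.measure_lt_top
  have hb : ∀ c : ℝ, |∫ y in Icc (a ∘ i.succAbove) (b ∘ i.succAbove),
      v (eL.symm (i.insertNth c y)) i|
      ≤ (volume (Icc (a ∘ i.succAbove) (b ∘ i.succAbove))).toReal := fun c => by
    have := norm_setIntegral_le_of_norm_le_const (C := 1) hfin
      (f := fun y => v (eL.symm (i.insertNth c y)) i) (fun y _ => hvi i _)
    simpa [Measure.real] using this
  have e1 := abs_le.1 (hb (b i))
  have e2 := abs_le.1 (hb (a i))
  linarith [e1.2, e2.1]

lemma isBVSet_box {d : ℕ} (a b : Fin d → ℝ) (hab : a ≤ b) : IsBVSet (box a b) :=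
  ⟨isBounded_box a b, (measurableSet_box a b).nullMeasurableSet, perimeter_box_lt_top a b hab⟩

lemma unitCube_eq_box (d : ℕ) : unitCube d = box (fun _ => 0) (fun _ => 1) := rfl

lemma dyadicCube_eq_box {d : ℕ} (n : ℕ) (k : Fin d → Fin (2 ^ n)) :
    dyadicCube n k = box (fun i => (k i : ℝ) / 2 ^ n) (fun i => ((k i : ℝ) + 1) / 2 ^ n) := rfl

lemma dyadicCube_subset {d : ℕ} (n : ℕ) (k : Fin d → Fin (2 ^ n)) :
    dyadicCube n k ⊆ unitCube d := by
  intro x hx i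
  have hk : ((k i : ℕ) : ℝ) + 1 ≤ 2 ^ n := by exact_mod_cast (k i).2
  refine ⟨le_trans (by positivity) (hx i).1, (hx i).2.trans ?_⟩
  rw [div_le_one (by positivity)]
  exact hk

lemma volume_dyadicCube {d : ℕ} (n : ℕ) (k : Fin d → Fin (2 ^ n)) :
    volume (dyadicCube n k) = ENNReal.ofReal ((2 ^ n : ℝ)⁻¹) ^ d := by
  rw [dyadicCube_eq_box, volume_box]
  have : ∀ i, ((k i : ℝ) + 1) / 2 ^ n - (k i : ℝ) / 2 ^ n = (2 ^ n : ℝ)⁻¹ := fun i => by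
    rw [← sub_div]
    simp
  simp [this]

/-- The unit cube as a `BV`-subset of itself. -/
def unitBV (d : ℕ) : BVSubset (unitCube d) :=
  ⟨unitCube d, subset_rfl, isBVSet_box _ _ fun _ => zero_le_one⟩

/-- A dyadic cube as a `BV`-subset of the unit cube. -/
def dyadicBV {d : ℕ} (n : ℕ) (k : Fin d → Fin (2 ^ n)) : BVSubset (unitCube d) :=
  ⟨dyadicCube n k, dyadicCube_subset n k, isBVSet_box _ _ fun i => by
    dsimp only
    gcongr
    linarith⟩

/-! ### Hölder charges and Hölder functions -/

/-- The space of `γ`-Hölder charges on the unit cube. -/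
def holderCharge (d : ℕ) (γ : ℝ) : Submodule ℝ (charge (unitCube d)) where
  carrier := {ω | ∃ κ : ℝ, 0 ≤ κ ∧ ∀ (n : ℕ) (k : Fin d → Fin (2 ^ n)),
    |ω.1 (dyadicBV n k)| ≤ κ * (volume (dyadicCube n k)).toReal ^ γ}
  zero_mem' := ⟨0, le_rfl, by simp⟩
  add_mem' := by
    rintro a b ⟨κ, h0, h⟩ ⟨κ', h0', h'⟩
    refine ⟨κ + κ', add_nonneg h0 h0', fun n k => ?_⟩
    rw [add_mul]
    exact (abs_add_le _ _).trans (add_le_add (h n k) (h' n k))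
  smul_mem' := by
    rintro c a ⟨κ, h0, h⟩
    refine ⟨|c| * κ, by positivity, fun n k => ?_⟩
    rw [mul_assoc]
    refine le_trans (le_of_eq (abs_mul c (a.1 (dyadicBV n k)))) ?_
    gcongr
    exact h n k

/-- The norm `‖ω‖_γ`: the supremum of `|ω(K)| / |K|^γ` over all dyadic cubes `K`. -/
def holderChargeNorm {d : ℕ} {γ : ℝ} (ω : holderCharge d γ) : ℝ :=
  ⨆ K : Σ n : ℕ, (Fin d → Fin (2 ^ n)),
    |ω.1.1 (dyadicBV K.1 K.2)| / (volume (dyadicCube K.1 K.2)).toReal ^ γ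

/-- The space `C^β([0, 1]^d)` of `β`-Hölder continuous functions on the unit cube. The Hölder
seminorm `Lip^β f` is `nnHolderNorm β f`. -/
def holderFun (d : ℕ) (β : ℝ≥0) : Submodule ℝ (unitCube d → ℝ) where
  carrier := {f | MemHolder β f}
  zero_mem' := memHolder_zero
  add_mem' := fun h h' => h.add h'
  smul_mem' := fun _ _ h => h.smul

/-- The Lebesgue measure on the unit cube. -/
def cubeMeasure (d : ℕ) : Measure (unitCube d) := volume.comap Subtype.val

/-- The supremum norm of a (bounded) function on the unit cube. -/
def supNorm {d : ℕ} (f : unitCube d → ℝ) : ℝ := ⨆ x, |f x|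

/-! ### Charges with a density -/

lemma isCharge_density {d : ℕ} {A : Set (E d)} {g : E d → ℝ} (hg : IntegrableOn g A) :
    IsCharge (fun B : BVSubset A => ∫ x in B.1, g x) := by
  refine ⟨fun B₁ B₂ B h h' => ?_, fun B B' h => ?_⟩
  · rw [h']
    exact setIntegral_union₀ h B₂.2.2.measurable (hg.mono_set B₁.2.1) (hg.mono_set B₂.2.1)
  · rw [tendsto_iff_norm_sub_tendsto_zero]
    have hlim : Tendsto (fun n => ∫⁻ x in symmDiff (B n).1 B'.1, ‖g x‖ₑ ∂(volume.restrict A))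
        atTop (𝓝 0) := by
      refine tendsto_setLIntegral_zero hg.2.ne ?_
      refine tendsto_of_tendsto_of_tendsto_of_le_of_le tendsto_const_nhds h.1
        (fun _ => bot_le) fun n => ?_
      exact Measure.restrict_apply_le _ _
    have hlim' := (ENNReal.tendsto_toReal ENNReal.zero_ne_top).comp hlim
    refine squeeze_zero (fun _ => norm_nonneg _) (fun n => ?_) hlim'
    have key : ∀ C : BVSubset A, ∫ x in C.1, g x
        = ∫ x in A, C.1.indicator g x := fun C => by
      rw [integral_indicator₀ (C.2.2.measurable.mono_ac
        Measure.restrict_le_self.absolutelyContinuous), Measure.restrict_restrict₀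
        (C.2.2.measurable.mono_ac Measure.restrict_le_self.absolutelyContinuous),
        inter_eq_self_of_subset_left C.2.1]
    have hnm : ∀ C : BVSubset A, NullMeasurableSet C.1 (volume.restrict A) := fun C =>
      C.2.2.measurable.mono_ac Measure.restrict_le_self.absolutelyContinuous
    rw [key, key, ← integral_sub (hg.indicator₀ (hnm _)) (hg.indicator₀ (hnm _))]
    refine (norm_integral_le_lintegral_norm _).trans ?_
    refine ENNReal.toReal_mono ((setLIntegral_le_lintegral _ _).trans_lt hg.2).ne ?_
    have hsd : NullMeasurableSet (symmDiff (B n).1 B'.1) (volume.restrict A) :=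
      ((hnm (B n)).diff (hnm B')).union ((hnm B').diff (hnm (B n)))
    refine le_trans (lintegral_mono fun x => ?_) (lintegral_indicator₀ hsd _).le
    rw [ofReal_norm]
    by_cases h1 : x ∈ (B n).1 <;> by_cases h2 : x ∈ B'.1 <;>
      simp [h1, h2, mem_symmDiff]

lemma one_le_exponent {γ : ℝ} (h0 : 0 < γ) (h1 : γ < 1) :
    (1 : ℝ≥0∞) ≤ ENNReal.ofReal (1 / (1 - γ)) := by
  rw [ENNReal.one_le_ofReal, le_div_iff₀ (by linarith)]
  linarith

lemma MemLp.integrableOn_cube {d : ℕ} {γ : ℝ} (h0 : 0 < γ) (h1 : γ < 1) {g : E d → ℝ}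
    (hg : MemLp g (ENNReal.ofReal (1 / (1 - γ))) (volume.restrict (unitCube d))) :
    IntegrableOn g (unitCube d) := by
  have : IsFiniteMeasure (volume.restrict (unitCube d)) :=
    ⟨by
      rw [Measure.restrict_apply_univ]
      exact (unitBV d).2.2.bounded.measure_lt_top⟩
  exact hg.integrable (one_le_exponent h0 h1)

/-- The charge `B ↦ ∫_B g` of density `g ∈ L^{1/(1-γ)}([0, 1]^d)`, which is `γ`-Hölder by
Hölder's inequality. -/
def densityCharge {d : ℕ} {γ : ℝ} (h0 : 0 < γ) (h1 : γ < 1) (g : E d → ℝ)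
    (hg : MemLp g (ENNReal.ofReal (1 / (1 - γ))) (volume.restrict (unitCube d))) :
    holderCharge d γ :=
  ⟨⟨fun B => ∫ x in B.1, g x, isCharge_density (MemLp.integrableOn_cube h0 h1 hg)⟩,
    (eLpNorm g (ENNReal.ofReal (1 / (1 - γ))) (volume.restrict (unitCube d))).toReal,
    ENNReal.toReal_nonneg, fun n k => by
      have hsub := dyadicCube_subset n k
      have hm : volume (dyadicCube n k) ≠ ∞ := (dyadicBV n k).2.2.bounded.measure_lt_top.ne
      have hgK : MemLp g (ENNReal.ofReal (1 / (1 - γ))) (volume.restrict (dyadicCube n k)) :=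
        hg.mono_measure (Measure.restrict_mono hsub le_rfl)
      have key := eLpNorm_le_eLpNorm_mul_rpow_measure_univ (one_le_exponent h0 h1)
        hgK.aestronglyMeasurable
      have hexp : 1 / (1 : ℝ≥0∞).toReal - 1 / (ENNReal.ofReal (1 / (1 - γ))).toReal = γ := by
        rw [ENNReal.toReal_ofReal (by have : 0 < 1 - γ := by linarith
                                      positivity)]
        simp
      rw [hexp, Measure.restrict_apply_univ, eLpNorm_one_eq_lintegral_enorm] at key
      have h3 : |∫ x in dyadicCube n k, g x| ≤ (∫⁻ x in dyadicCube n k, ‖g x‖ₑ).toReal := by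
        have h4 := norm_integral_le_lintegral_norm (μ := volume.restrict (dyadicCube n k)) g
        simp only [ofReal_norm] at h4
        exact h4
      refine h3.trans ?_
      rw [ENNReal.toReal_rpow, ← ENNReal.toReal_mul]
      refine ENNReal.toReal_mono (ENNReal.mul_lt_top hg.2
        (ENNReal.rpow_lt_top_of_nonneg h0.le hm)).ne (key.trans ?_)
      exact mul_le_mul' (eLpNorm_mono_measure g (Measure.restrict_mono hsub le_rfl)) le_rfl⟩

/-! ### Haar functions and Faber-Schauder coefficients -/

/-- The entries of the Haar matrix of order `2^d`, whose rows and columns are indexed by binary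
expansions of length `d`: the `d`-fold tensor power of `!![1, 1; 1, -1]`. -/
def haarMatrix (d : ℕ) : Matrix (Fin d → Fin 2) (Fin d → Fin 2) ℝ :=
  fun r l => ∏ i, (!![1, 1; 1, -1] : Matrix (Fin 2) (Fin 2) ℝ) (r i) (l i)

/-- The block recursion that characterizes the Haar matrices. -/
lemma haarMatrix_succ (d : ℕ) (a b : Fin 2) (r l : Fin d → Fin 2) :
    haarMatrix (d + 1) (Fin.cons a r : Fin (d + 1) → Fin 2) (Fin.cons b l : Fin (d + 1) → Fin 2)
      = (!![1, 1; 1, -1] : Matrix (Fin 2) (Fin 2) ℝ) a b * haarMatrix d r l := by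
  simp [haarMatrix, Fin.prod_univ_succ]

/-- The index of a child (in the next generation) of the dyadic cube of index `k`. -/
def child {d n : ℕ} (k : Fin d → Fin (2 ^ n)) (l : Fin d → Fin 2) : Fin d → Fin (2 ^ (n + 1)) :=
  fun i => ⟨2 * (k i : ℕ) + (l i : ℕ), by
    have h1 := (k i).2
    have h2 := (l i).2
    rw [pow_succ]
    omega⟩

/-- The Haar function `g_{n,k,r}`, supported in the dyadic cube of generation `n` and index `k`,
of type `r ≠ 0`. -/
def haarFun {d : ℕ} (n : ℕ) (k : Fin d → Fin (2 ^ n)) (r : Fin d → Fin 2) (x : E d) : ℝ :=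
  (2 : ℝ) ^ ((n * d : ℝ) / 2) *
    ∑ l, haarMatrix d r l * (dyadicCube (n + 1) (child k l)).indicator (fun _ => (1 : ℝ)) x

/-- The Faber-Schauder coefficient `a_{n,k,r}(ω)` of a charge. -/
def faberCoeff {d : ℕ} (ω : charge (unitCube d)) (n : ℕ) (k : Fin d → Fin (2 ^ n))
    (r : Fin d → Fin 2) : ℝ :=
  (2 : ℝ) ^ ((n * d : ℝ) / 2) * ∑ l, haarMatrix d r l * ω.1 (dyadicBV (n + 1) (child k l))

/-! ### The two defining properties of the Young integral -/

/-- On charges with a density, the integral is the Lebesgue integral against the density. -/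
def AgreesWithLebesgue {d : ℕ} {β : ℝ≥0} {γ : ℝ} (h0 : 0 < γ) (h1 : γ < 1)
    (I : holderFun d β →ₗ[ℝ] holderCharge d γ →ₗ[ℝ] ℝ) : Prop :=
  ∀ (f : holderFun d β) (g : E d → ℝ)
    (hg : MemLp g (ENNReal.ofReal (1 / (1 - γ))) (volume.restrict (unitCube d))),
    I f (densityCharge h0 h1 g hg) = ∫ x, f.1 x * g x ∂(cubeMeasure d)

/-- Continuity along sequences `(f_p)`, `(ω_p)` with bounded Hölder (semi)norms, such that `f_p`
converges uniformly to `f` and `ω_p` converges to `ω` in the norm of strong charges. That the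
limits are Hölder again is part of the property. -/
def IsSeqContinuous {d : ℕ} {β : ℝ≥0} {γ : ℝ}
    (I : holderFun d β →ₗ[ℝ] holderCharge d γ →ₗ[ℝ] ℝ) : Prop :=
  ∀ (f : ℕ → holderFun d β) (f' : unitCube d → ℝ)
    (ω : ℕ → holderCharge d γ) (ω' : charge (unitCube d)),
    TendstoUniformly (fun p => (f p).1) f' atTop →
    BddAbove (range fun p => nnHolderNorm β (f p).1) →
    IsStrong ω' →
    Tendsto (fun p => strongNorm ((ω p).1 - ω')) atTop (𝓝 0) →
    BddAbove (range fun p => holderChargeNorm (ω p)) →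
    ∃ (hf : f' ∈ holderFun d β) (hω : ω' ∈ holderCharge d γ),
      Tendsto (fun p => I (f p) (ω p)) atTop (𝓝 (I ⟨f', hf⟩ ⟨ω', hω⟩))

end YoungCharge

end

open YoungCharge

noncomputable section

namespace YoungCharge

/-! ### Translates of functions of bounded variation -/

/-! Existence. The integral is the limit of the sums `youngSum`, which add, over the cubes `K` of
generation `n`, `ω(K)` times the mean of `f` over `K`. Distributing `ω(K)` over the children `K'` of
`K` turns the increment from `n` to `n + 1` into a sum of `2^((n+1)d)` terms `ω(K') (mean_{K'} f -
mean_K f)`, each at most a constant times `2^(-ndγ) 2^(-nβ)`. Increments thus decay like `2^(n(d -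
dγ - β))`, which is geometric because `β + dγ > d` (`abs_youngSum_succ_sub_le`). By orthogonality of
the Haar matrix the increment is exactly the `n`-th block of the Faber–Schauder series
(`sum_faberCoeff_mul_eq`). Summation gives the formula and the bound. Against a density `g`, the sum
misses `∫ f g` by at most the oscillation of `f` on cubes times the `L¹` norm of `g`, which gives
(A). The tails are uniform over bounded Hölder norms and each finite sum is continuous in `(f, ω)`,
which gives (B).

Uniqueness. It suffices to approximate a Hölder charge `ω`, in the strong norm and with bounded
Hölder norms, by charges with bounded densities. The approximants have density `ω(K)/|K|` on the
cubes of generation `n`. Two consecutive densities differ by a function `ψ` of mean zero on each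
cube of generation `n` and of size `O(2^(nd(1-γ)))`. Subtracting from `u` its cell averages and
using the Poincaré inequality `lintegral_sub_cellAverage_le` bounds `∫ ψ u` by `O(2^(n(d - dγ -
1)))` times the variation of `u` (`dist_stepFunctional_le`). As `β < 1`, this is geometric too, so
the functionals converge in the dual to some strong `α`.

It remains to see that `α` represents `ω`. Both define charges and they agree on dyadic cubes; a
charge is determined by these values because each `BV`-set is a `BV`-limit of dyadic figures
(`bvConverges_majority`). The figure consists of the cubes at least half covered by the set. The
Poincaré inequality controls the symmetric difference, and comparing one-cell translates bounds the
perimeters uniformly in `n`.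

Everything about variation rests on `∫ |u(x + h) - u(x)| dx ≤ |h| V u` and on a partial converse for
step functions (`variation_step_le`). -/

lemma variation_congr_ae {d : ℕ} {u w : E d → ℝ} (h : u =ᵐ[volume] w) :
    variation u = variation w := by
  unfold variation
  congr! 4 with v _
  refine integral_congr_ae ?_
  filter_upwards [h] with x hx
  rw [hx]

lemma IsTestField.abs_integral_le {d : ℕ} {v : E d → E d} (hv : IsTestField v) {u : E d → ℝ}
    (hu : variation u ≠ ∞) : |∫ x, u x * divergence v x| ≤ (variation u).toReal := by
  refine abs_le'.2 ⟨(ENNReal.ofReal_le_iff_le_toReal hu).1 (hv.ofReal_le u), ?_⟩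
  have := (ENNReal.ofReal_le_iff_le_toReal hu).1 (hv.neg.ofReal_le u)
  simpa [divergence_neg, integral_neg] using this

/-- The scalar test functions: of class `C^1`, with compact support and values in `[-1, 1]`. -/
structure IsTestFun {d : ℕ} (φ : E d → ℝ) : Prop where
  contDiff : ContDiff ℝ 1 φ
  hasCompactSupport : HasCompactSupport φ
  abs_le : ∀ x, |φ x| ≤ 1

lemma IsTestFun.isTestField {d : ℕ} {φ : E d → ℝ} (hφ : IsTestFun φ) {w : E d} (hw : ‖w‖ ≤ 1) :
    IsTestField (fun x => φ x • w) := by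
  refine ⟨hφ.contDiff.smul contDiff_const, hφ.hasCompactSupport.smul_right, fun x => ?_⟩
  rw [norm_smul]
  exact mul_le_one₀ (hφ.abs_le x) (norm_nonneg _) hw

lemma divergence_smul_const {d : ℕ} {φ : E d → ℝ} (hφ : ContDiff ℝ 1 φ) (w x : E d) :
    divergence (fun y => φ y • w) x = fderiv ℝ φ x w := by
  have hd := hφ.differentiable (by simp) x
  have hw : w = ∑ i, w i • EuclideanSpace.single i (1 : ℝ) := by
    ext j
    simp [Finset.sum_apply, Pi.single_apply]
  conv_rhs => rw [hw]
  simp [divergence, fderiv_smul_const hd, map_sum, mul_comm]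

/-- The field `φ · h/‖h‖` is admissible, and its divergence is the derivative of `φ` along `h/‖h‖`.
-/
lemma IsTestFun.abs_integral_fderiv_le {d : ℕ} {φ : E d → ℝ} (hφ : IsTestFun φ) {u : E d → ℝ}
    (hu : variation u ≠ ∞) (h : E d) :
    |∫ x, u x * fderiv ℝ φ x h| ≤ ‖h‖ * (variation u).toReal := by
  rcases eq_or_ne h 0 with rfl | hh
  · simp
  have hn : ‖h‖ ≠ 0 := norm_ne_zero_iff.2 hh
  have key := (hφ.isTestField (w := ‖h‖⁻¹ • h) (by rw [norm_smul]; simp [hn])).abs_integral_le hu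
  simp_rw [divergence_smul_const hφ.contDiff, map_smul, smul_eq_mul, mul_left_comm _ (‖h‖⁻¹),
    integral_const_mul, abs_mul, abs_inv, abs_norm] at key
  rwa [inv_mul_le_iff₀ (by positivity)] at key

lemma IsTestFun.comp_sub {d : ℕ} {φ : E d → ℝ} (hφ : IsTestFun φ) (h : E d) :
    IsTestFun (fun x => φ (x - h)) := by
  refine ⟨hφ.contDiff.comp (contDiff_id.sub contDiff_const), ?_, fun x => hφ.abs_le _⟩
  exact hφ.hasCompactSupport.comp_homeomorph (Homeomorph.subRight h)

lemma IsTestFun.continuous_fderiv {d : ℕ} {φ : E d → ℝ} (hφ : IsTestFun φ) :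
    Continuous (fderiv ℝ φ) := hφ.contDiff.continuous_fderiv (by simp)

lemma IsTestFun.exists_norm_fderiv_le {d : ℕ} {φ : E d → ℝ} (hφ : IsTestFun φ) :
    ∃ C, ∀ x, ‖fderiv ℝ φ x‖ ≤ C :=
  (hφ.hasCompactSupport.fderiv (𝕜 := ℝ)).exists_bound_of_continuous hφ.continuous_fderiv

lemma IsTestFun.integrable_mul {d : ℕ} {φ : E d → ℝ} (hφ : IsTestFun φ) {u : E d → ℝ}
    (hu : Integrable u) : Integrable (fun x => u x * φ x) :=
  hu.mul_bdd (c := 1) hφ.contDiff.continuous.aestronglyMeasurable (ae_of_all _ hφ.abs_le)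

/-- The translation is carried by the smooth factor, so differentiation under the integral needs no
regularity of `u`; `|u| C ‖h‖` dominates. -/
lemma IsTestFun.hasDerivAt_integral_mul {d : ℕ} {φ : E d → ℝ} (hφ : IsTestFun φ) {u : E d → ℝ}
    (hi : Integrable u) (h : E d) (t : ℝ) :
    HasDerivAt (fun s : ℝ => ∫ x, u x * φ (x - s • h))
      (∫ x, u x * fderiv ℝ φ (x - t • h) (-h)) t := by
  obtain ⟨C, hC⟩ := hφ.exists_norm_fderiv_le
  have hd := hφ.contDiff.differentiable (by simp)
  refine (hasDerivAt_integral_of_dominated_loc_of_deriv_le (s := univ) univ_mem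
    (F' := fun s x => u x * fderiv ℝ φ (x - s • h) (-h)) (bound := fun x => ‖u x‖ * (C * ‖h‖))
    (Eventually.of_forall fun s => ((hφ.comp_sub (s • h)).integrable_mul hi).1)
    ((hφ.comp_sub (t • h)).integrable_mul hi) ?_ ?_ (hi.norm.mul_const _) ?_).2
  · refine hi.1.mul (Continuous.aestronglyMeasurable ?_)
    have := hφ.continuous_fderiv
    fun_prop
  · refine ae_of_all _ fun x s _ => ?_
    rw [norm_mul]
    gcongr
    refine (ContinuousLinearMap.le_opNorm _ _).trans ?_
    rw [norm_neg]
    gcongr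
    exact hC _
  · refine ae_of_all _ fun x s _ => ?_
    refine HasDerivAt.const_mul _ ?_
    have h1 : HasDerivAt (fun s : ℝ => x - s • h) (-h) s := by
      simpa using ((hasDerivAt_id s).smul_const h).const_sub x
    exact (hd (x - s • h)).hasFDerivAt.comp_hasDerivAt s h1

lemma IsTestFun.abs_integral_mul_sub_le {d : ℕ} {φ : E d → ℝ} (hφ : IsTestFun φ) {u : E d → ℝ}
    (hi : Integrable u) (hu : variation u ≠ ∞) (h : E d) :
    |(∫ x, u x * φ (x - h)) - ∫ x, u x * φ x| ≤ ‖h‖ * (variation u).toReal := by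
  have hb : ∀ t : ℝ, ‖∫ x, u x * fderiv ℝ φ (x - t • h) (-h)‖ ≤ ‖h‖ * (variation u).toReal :=
    fun t => by
      have := (hφ.comp_sub (t • h)).abs_integral_fderiv_le hu (-h)
      rw [norm_neg] at this
      simpa only [fderiv_comp_sub, Real.norm_eq_abs] using this
  have key := (convex_univ (𝕜 := ℝ) (E := ℝ)).norm_image_sub_le_of_norm_hasDerivWithin_le
    
    (fun t _ => (hφ.hasDerivAt_integral_mul hi h t).hasDerivWithinAt) (fun t _ => hb t)
    (mem_univ 0) (mem_univ 1)
  simpa using key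

/-- Duality for the `L¹` norm with `C¹` test functions only: replace `w` by a smooth compactly
supported `g` close in `L¹`, and test with a regularized sign of `g`. The three errors are `ε/3`
each. -/
lemma integral_norm_le_of_testFun {d : ℕ} {w : E d → ℝ} (hw : Integrable w) {C : ℝ}
    (h : ∀ φ : E d → ℝ, IsTestFun φ → ∫ x, w x * φ x ≤ C) : ∫ x, ‖w x‖ ≤ C := by
  refine le_of_forall_pos_le_add fun ε hε => ?_
  obtain ⟨g, hgs, hgc, hg⟩ := 
    (memLp_one_iff_integrable.2 hw).exist_eLpNorm_sub_le (by simp) le_rfl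
      (show 0 < ε / 3 by positivity)
  have hgi : Integrable g := hgc.continuous.integrable_of_hasCompactSupport hgs
  have hwi : Integrable (fun x => w x - g x) := hw.sub hgi
  have hwg : ∫ x, ‖w x - g x‖ ≤ ε / 3 := by
    rw [integral_norm_eq_lintegral_enorm hwi.1]
    rw [eLpNorm_one_eq_lintegral_enorm] at hg
    exact ENNReal.toReal_le_of_le_ofReal (by positivity) hg
  set K := tsupport g
  have hK : IsCompact K := hgs
  set M := volume.real K
  have hM : 0 ≤ M := measureReal_nonneg
  -- Regularizing the sign costs at most `δ` pointwise on the support of `g`, hence `M δ ≤ ε/3` in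
  -- total; `M + 1` avoids dividing by zero.
  set δ := ε / (3 * (M + 1)) with hδ
  have hδ0 : 0 < δ := by positivity
  have hs : ∀ x, 0 < g x ^ 2 + δ ^ 2 := fun x => by positivity
  set φ : E d → ℝ := fun x => g x / √(g x ^ 2 + δ ^ 2) with hφdef
  have hg1 : ContDiff ℝ 1 g := hgc.of_le (by exact_mod_cast le_top)
  have hle : ∀ x, |g x| ≤ √(g x ^ 2 + δ ^ 2) := fun x =>
    Real.abs_le_sqrt (by linarith [sq_nonneg δ])
  have hφ : IsTestFun φ := by
    refine ⟨hg1.div (((hg1.pow 2).add contDiff_const).sqrt fun x => (hs x).ne')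
      fun x => (Real.sqrt_pos.2 (hs x)).ne', ?_, fun x => ?_⟩
    · refine hgs.mono fun x hx h0 => hx ?_
      simp [hφdef, h0]
    · rw [hφdef, abs_div, abs_of_nonneg (Real.sqrt_nonneg _)]
      exact div_le_one_of_le₀ (hle x) (Real.sqrt_nonneg _)
  have hpt : ∀ x, ‖g x‖ - g x * φ x ≤ K.indicator (fun _ => δ) x := fun x => by
    by_cases hx : x ∈ K
    · rw [indicator_of_mem hx, Real.norm_eq_abs]
      have h1 := Real.sqrt_pos.2 (hs x)
      have h2 : √(g x ^ 2 + δ ^ 2) ≤ |g x| + δ := by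
        rw [Real.sqrt_le_left (by positivity), ← sq_abs (g x)]
        nlinarith [abs_nonneg (g x)]
      have h3 : |g x| - g x * φ x
          = |g x| / √(g x ^ 2 + δ ^ 2) * (√(g x ^ 2 + δ ^ 2) - |g x|) := by
        rw [hφdef]
        field_simp
        rw [mul_sub, ← pow_two |g x|, sq_abs]
      rw [h3]
      calc _ ≤ 1 * (√(g x ^ 2 + δ ^ 2) - |g x|) := by
            gcongr
            · linarith [hle x]
            · exact div_le_one_of_le₀ (hle x) (Real.sqrt_nonneg _)
        _ ≤ δ := by linarith
    · have : g x = 0 := image_eq_zero_of_notMem_tsupport hx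
      simp [this, hx]
  have h1 : ∫ x, ‖g x‖ - g x * φ x ≤ M * δ := by
    refine (integral_mono (hgi.norm.sub (hφ.integrable_mul hgi)) ?_ hpt).trans ?_
    · exact (integrableOn_const hK.measure_lt_top.ne).integrable_indicator hK.measurableSet
    · rw [integral_indicator hK.measurableSet]
      simp [M]
  have h2 : M * δ ≤ ε / 3 := by
    rw [hδ]
    field_simp
    linarith
  rw [integral_sub hgi.norm (hφ.integrable_mul hgi)] at h1
  have h3 : ∫ x, ‖w x‖ ≤ ∫ x, (‖w x - g x‖ + ‖g x‖) :=
    integral_mono hw.norm (hwi.norm.add hgi.norm) fun x => by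
      simpa using norm_add_le (w x - g x) (g x)
  rw [integral_add hwi.norm hgi.norm] at h3
  have h4 : ∫ x, g x * φ x ≤ ∫ x, (w x * φ x + ‖w x - g x‖) :=
    integral_mono (hφ.integrable_mul hgi) ((hφ.integrable_mul hw).add hwi.norm) fun x => by
      have h5 : |(g x - w x) * φ x| ≤ |w x - g x| := by
        rw [abs_mul, abs_sub_comm]
        exact mul_le_of_le_one_right (abs_nonneg _) (hφ.abs_le x)
      have := (le_abs_self _).trans h5
      simp only [Real.norm_eq_abs]
      linarith
  rw [integral_add (hφ.integrable_mul hw) hwi.norm] at h4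
  linarith [h φ hφ]

/-- By duality the translate can be moved onto the test function, where the mean value inequality
applies. -/
lemma integral_norm_translate_sub_le {d : ℕ} {u : E d → ℝ} (hi : Integrable u)
    (hu : variation u ≠ ∞) (h : E d) :
    ∫ x, ‖u (x + h) - u x‖ ≤ ‖h‖ * (variation u).toReal := by
  have hih : Integrable (fun x => u (x + h)) := hi.comp_add_right h
  refine integral_norm_le_of_testFun (hih.sub hi) fun φ hφ => ?_
  have h1 : ∫ x, u (x + h) * φ x = ∫ x, u x * φ (x - h) := by
    rw [← integral_add_right_eq_self (fun x => u x * φ (x - h)) h]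
    simp
  have h2 : ∀ x, (u (x + h) - u x) * φ x = u (x + h) * φ x - u x * φ x := fun x => sub_mul _ _ _
  simp_rw [Pi.sub_apply, h2]
  rw [integral_sub (hφ.integrable_mul hih) (hφ.integrable_mul hi), h1]
  exact (le_abs_self _).trans (hφ.abs_integral_mul_sub_le hi hu h)

lemma lintegral_translate_sub_le {d : ℕ} {u : E d → ℝ} (hi : Integrable u) (h : E d) :
    ∫⁻ x, ‖u (x + h) - u x‖ₑ ≤ ‖h‖ₑ * variation u := by
  rcases eq_or_ne h 0 with rfl | hh
  · simp
  by_cases hu : variation u = ∞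
  · rw [hu, ENNReal.mul_top (by simpa using hh)]
    exact le_top
  have h1 := integral_norm_translate_sub_le hi hu h
  have hw : Integrable (fun x => u (x + h) - u x) := (hi.comp_add_right h).sub hi
  rw [integral_norm_eq_lintegral_enorm hw.1] at h1
  have hfin : ∫⁻ x, ‖u (x + h) - u x‖ₑ ≠ ∞ := hw.2.ne
  rw [← ENNReal.ofReal_toReal hfin, ← ENNReal.ofReal_toReal hu, ← ofReal_norm,
    ← ENNReal.ofReal_mul (norm_nonneg _)]
  exact ENNReal.ofReal_le_ofReal h1

/-- Substituting `y = x + h` and exchanging the integrals reduces this to the translation estimate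
for each `‖h‖ ≤ ρ`. Genuine measurability of `u` makes the integrand jointly measurable. -/
lemma lintegral_closedBall_translate_sub_le {d : ℕ} {u : E d → ℝ} (hi : Integrable u)
    (hm : Measurable u) (ρ : ℝ≥0) :
    ∫⁻ x, ∫⁻ y in Metric.closedBall x ρ, ‖u y - u x‖ₑ
      ≤ volume (Metric.closedBall (0 : E d) ρ) * ρ * variation u := by
  have h1 : ∀ x, ∫⁻ y in Metric.closedBall x ρ, ‖u y - u x‖ₑ
      = ∫⁻ h in Metric.closedBall (0 : E d) ρ, ‖u (x + h) - u x‖ₑ := fun x => by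
    rw [← lintegral_indicator Metric.isClosed_closedBall.measurableSet,
      ← lintegral_indicator Metric.isClosed_closedBall.measurableSet,
      ← lintegral_add_left_eq_self _ x]
    congr! 2 with h
    simp [indicator]
  simp_rw [h1]
  rw [lintegral_lintegral_swap (by
    refine Measurable.aemeasurable ?_
    unfold Function.uncurry
    fun_prop)]
  calc ∫⁻ h in Metric.closedBall (0 : E d) ρ, ∫⁻ x, ‖u (x + h) - u x‖ₑ
      ≤ ∫⁻ h in Metric.closedBall (0 : E d) ρ, ρ * variation u := by
        refine setLIntegral_mono (by fun_prop) fun h hh => ?_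
        refine (lintegral_translate_sub_le hi h).trans ?_
        gcongr
        rw [enorm_le_coe]
        simpa [← NNReal.coe_le_coe] using hh
    _ = _ := by rw [setLIntegral_const]; ring

/-- A translation by `2` along a coordinate axis moves the cube off itself, so on the cube `u(x + h)
- u(x)` is `-u(x)`. This makes bounded densities act continuously on `BV`. -/
lemma lintegral_enorm_le_variation {d : ℕ} (hd : 1 ≤ d) {u : E d → ℝ} (hi : Integrable u)
    (hs : ∀ᵐ x, x ∉ unitCube d → u x = 0) : ∫⁻ x, ‖u x‖ₑ ≤ 2 * variation u := by
  let i : Fin d := ⟨0, hd⟩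
  set h : E d := EuclideanSpace.single i 2 with hh
  have hs' : ∀ᵐ x, x + h ∉ unitCube d → u (x + h) = 0 :=
    (measurePreserving_add_right (volume : Measure (E d)) h).quasiMeasurePreserving.ae hs
  have h1 : ∫⁻ x, ‖u x‖ₑ ≤ ∫⁻ x, ‖u (x + h) - u x‖ₑ := by
    refine lintegral_mono_ae ?_
    filter_upwards [hs, hs'] with x hx hx'
    by_cases hxc : x ∈ unitCube d
    · rw [hx' fun h' => ?_]
      · simp
      have h2 := (h' i).2
      have h3 := (hxc i).1
      simp [hh] at h2
      linarith
    · simp [hx hxc]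
  refine h1.trans ((lintegral_translate_sub_le hi h).trans ?_)
  gcongr
  rw [hh, ← ofReal_norm]
  simp

/-! ### The dyadic grid -/

/-- The index of the half-open dyadic cell of generation `n` that contains `x`. -/
def gridIndex {d : ℕ} (n : ℕ) (x : E d) : Fin d → ℤ := fun i => ⌊x i * 2 ^ n⌋

/-- The half-open dyadic cell of generation `n` and index `k`. -/
def gridCell {d : ℕ} (n : ℕ) (k : Fin d → ℤ) : Set (E d) := gridIndex n ⁻¹' {k}

lemma measurable_gridIndex {d : ℕ} (n : ℕ) : Measurable (gridIndex n : E d → Fin d → ℤ) := by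
  refine measurable_pi_lambda _ fun i => Int.measurable_floor.comp ?_
  fun_prop

lemma measurableSet_gridCell {d : ℕ} (n : ℕ) (k : Fin d → ℤ) :
    MeasurableSet (gridCell n k : Set (E d)) :=
  measurable_gridIndex n (measurableSet_singleton k)

lemma gridCell_eq_preimage {d : ℕ} (n : ℕ) (k : Fin d → ℤ) :
    (gridCell n k : Set (E d)) = WithLp.ofLp ⁻¹'
      (univ.pi fun i => Ico ((k i : ℝ) / 2 ^ n) (((k i : ℝ) + 1) / 2 ^ n)) := by
  ext x
  have h2 : (0 : ℝ) < 2 ^ n := by positivity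
  simp [gridCell, gridIndex, funext_iff, Int.floor_eq_iff, div_le_iff₀ h2, lt_div_iff₀ h2]

lemma ofLp_preimage_ae_eq {d : ℕ} {s t : Set (Fin d → ℝ)} (h : s =ᵐ[volume] t) :
    (WithLp.ofLp ⁻¹' s : Set (E d)) =ᵐ[volume] WithLp.ofLp ⁻¹' t :=
  (PiLp.volume_preserving_ofLp (Fin d)).quasiMeasurePreserving.preimage_ae_eq h

lemma box_ae_eq_gridCell {d : ℕ} (n : ℕ) (k : Fin d → ℤ) :
    box (fun i => (k i : ℝ) / 2 ^ n) (fun i => ((k i : ℝ) + 1) / 2 ^ n)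
      =ᵐ[volume] (gridCell n k : Set (E d)) := by
  rw [box_eq_preimage, gridCell_eq_preimage]
  exact ofLp_preimage_ae_eq Measure.univ_pi_Ico_ae_eq_Icc.symm

lemma volume_gridCell {d : ℕ} (n : ℕ) (k : Fin d → ℤ) :
    volume (gridCell n k : Set (E d)) = ENNReal.ofReal ((2 ^ n : ℝ)⁻¹) ^ d := by
  rw [← measure_congr (box_ae_eq_gridCell n k), volume_box]
  have : ∀ i, ((k i : ℝ) + 1) / 2 ^ n - (k i : ℝ) / 2 ^ n = (2 ^ n : ℝ)⁻¹ := fun i => by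
    rw [← sub_div]
    simp
  simp [this]

/-- The index of a dyadic subcube of the unit cube, as an index of the whole grid. -/
def toGrid {d n : ℕ} (k : Fin d → Fin (2 ^ n)) : Fin d → ℤ := fun i => ((k i : ℕ) : ℤ)

lemma toGrid_injective {d n : ℕ} :
    Function.Injective (toGrid : (Fin d → Fin (2 ^ n)) → Fin d → ℤ) := by
  intro k k' h
  ext i
  simpa [toGrid] using congrFun h i

/-- Closed cubes overlap along faces, whereas half-open cells partition space; passing between them
loses only null sets. -/
lemma dyadicCube_ae_eq_gridCell {d : ℕ} (n : ℕ) (k : Fin d → Fin (2 ^ n)) :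
    dyadicCube n k =ᵐ[volume] gridCell n (toGrid k) := by
  have := box_ae_eq_gridCell n (toGrid k)
  simpa [toGrid, ← dyadicCube_eq_box] using this

lemma measurableSet_dyadicCube {d : ℕ} (n : ℕ) (k : Fin d → Fin (2 ^ n)) :
    MeasurableSet (dyadicCube n k) := measurableSet_box _ _

lemma measurableSet_unitCube (d : ℕ) : MeasurableSet (unitCube d) := measurableSet_box _ _

lemma volume_inter_dyadicCube {d : ℕ} {n : ℕ} {k k' : Fin d → Fin (2 ^ n)} (h : k ≠ k') :
    volume (dyadicCube n k ∩ dyadicCube n k') = 0 := by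
  rw [measure_congr ((dyadicCube_ae_eq_gridCell n k).inter (dyadicCube_ae_eq_gridCell n k'))]
  have : (gridCell n (toGrid k) ∩ gridCell n (toGrid k') : Set (E d)) = ∅ := by
    refine Set.disjoint_iff_inter_eq_empty.1 (Disjoint.preimage _ ?_)
    simpa using toGrid_injective.ne h
  rw [this, measure_empty]

lemma norm_sub_le_of_forall_abs_le {d : ℕ} {x y : E d} {c : ℝ} (hc : 0 ≤ c)
    (h : ∀ i, |x i - y i| ≤ c) : ‖x - y‖ ≤ √d * c := by
  rw [EuclideanSpace.norm_eq]
  refine Real.sqrt_le_iff.2 ⟨by positivity, ?_⟩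
  calc ∑ i, ‖(x - y) i‖ ^ 2 ≤ ∑ _i : Fin d, c ^ 2 := by
        refine Finset.sum_le_sum fun i _ => ?_
        gcongr
        exact h i
    _ = _ := by simp [mul_pow]

lemma norm_sub_le_of_mem_dyadicCube {d : ℕ} {n : ℕ} {k : Fin d → Fin (2 ^ n)} {x y : E d}
    (hx : x ∈ dyadicCube n k) (hy : y ∈ dyadicCube n k) : ‖x - y‖ ≤ √d * (2 ^ n : ℝ)⁻¹ := by
  refine norm_sub_le_of_forall_abs_le (by positivity) fun i => ?_
  have h1 := hx i
  have h2 := hy i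
  rw [add_div] at h1 h2
  rw [abs_le, ← one_div]
  constructor <;> linarith [h1.1, h1.2, h2.1, h2.2]

lemma norm_sub_le_of_gridIndex_eq {d : ℕ} {n : ℕ} {x y : E d}
    (h : gridIndex n x = gridIndex n y) : ‖x - y‖ ≤ √d * (2 ^ n : ℝ)⁻¹ := by
  refine norm_sub_le_of_forall_abs_le (by positivity) fun i => ?_
  have h1 := (Int.abs_sub_lt_one_of_floor_eq_floor (congrFun h i)).le
  rw [← sub_mul, abs_mul, abs_of_pos (show (0 : ℝ) < 2 ^ n by positivity)] at h1
  rwa [← one_div, le_div_iff₀ (by positivity)]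

/-! ### Children of dyadic cubes -/

lemma child_bijective (d n : ℕ) : Function.Bijective
    (fun p : (Fin d → Fin (2 ^ n)) × (Fin d → Fin 2) => child p.1 p.2) := by
  constructor
  · rintro ⟨k, l⟩ ⟨k', l'⟩ h
    have h' : ∀ i, 2 * (k i : ℕ) + (l i : ℕ) = 2 * (k' i : ℕ) + (l' i : ℕ) := fun i =>
      congrArg Fin.val (congrFun h i)
    refine Prod.ext (funext fun i => Fin.ext ?_) (funext fun i => Fin.ext ?_) <;>
    · have h1 := h' i
      have h2 := (l i).2
      have h3 := (l' i).2
      simp only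
      omega
  · intro k
    refine ⟨(fun i => ⟨k i / 2, ?_⟩, fun i => ⟨k i % 2, Nat.mod_lt _ two_pos⟩), ?_⟩
    · have h1 := (k i).2
      have h2 : 2 ^ (n + 1) = 2 ^ n * 2 := pow_succ 2 n
      omega
    · ext i
      simp [child, Nat.div_add_mod]

lemma child_injective {d n : ℕ} (k : Fin d → Fin (2 ^ n)) :
    Function.Injective (child k) := fun l l' h =>
  congrArg Prod.snd ((child_bijective d n).1 (a₁ := (k, l)) (a₂ := (k, l')) h)

lemma sum_child {d n : ℕ} {M : Type*} [AddCommMonoid M] (F : (Fin d → Fin (2 ^ (n + 1))) → M) :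
    ∑ k, F k = ∑ k : Fin d → Fin (2 ^ n), ∑ l : Fin d → Fin 2, F (child k l) := by
  rw [← Fintype.sum_prod_type', ← (child_bijective d n).sum_comp]

lemma iUnion_child {d n : ℕ} (k : Fin d → Fin (2 ^ n)) :
    ⋃ l, dyadicCube (n + 1) (child k l) = dyadicCube n k := by
  have h2 : (0 : ℝ) < 2 ^ n := by positivity
  ext x
  simp only [mem_iUnion]
  constructor
  · rintro ⟨l, hl⟩ i
    obtain ⟨h3, h4⟩ := hl i
    have hl2 : ((l i : ℕ) : ℝ) ≤ 1 := by exact_mod_cast Nat.le_of_lt_succ (l i).2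
    have hl0 : (0 : ℝ) ≤ ((l i : ℕ) : ℝ) := by positivity
    simp only [child, pow_succ, Nat.cast_add, Nat.cast_mul, Nat.cast_ofNat] at h3 h4
    rw [div_le_iff₀ (by positivity)] at h3
    rw [le_div_iff₀ (by positivity)] at h4
    constructor
    · rw [div_le_iff₀ h2]
      linarith
    · rw [le_div_iff₀ h2]
      linarith
  · intro hx
    -- In each coordinate the midpoint of the parent decides the child; ties go to the lower half.
    refine ⟨fun i => if x i * 2 ^ (n + 1) ≤ 2 * (k i : ℝ) + 1 then 0 else 1, fun i => ?_⟩
    obtain ⟨h3, h4⟩ := hx i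
    rw [div_le_iff₀ h2] at h3
    rw [le_div_iff₀ h2] at h4
    simp only [child, mem_Icc, div_le_iff₀ (show (0 : ℝ) < 2 ^ (n + 1) by positivity),
      le_div_iff₀ (show (0 : ℝ) < 2 ^ (n + 1) by positivity)]
    split_ifs with h
    · rw [pow_succ] at *
      push_cast
      constructor <;> simp <;> linarith
    · rw [pow_succ] at *
      push_cast
      constructor <;> simp <;> linarith

lemma dyadicCube_zero {d : ℕ} (k : Fin d → Fin (2 ^ 0)) : dyadicCube 0 k = unitCube d := by
  ext x
  simp [dyadicCube, unitCube]

lemma dyadicBV_zero {d : ℕ} (k : Fin d → Fin (2 ^ 0)) : dyadicBV 0 k = unitBV d :=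
  Subtype.ext (dyadicCube_zero k)

lemma iUnion_dyadicCube (d n : ℕ) : ⋃ k, dyadicCube n k = unitCube d := by
  refine subset_antisymm (iUnion_subset fun k => dyadicCube_subset n k) ?_
  induction n with
  | zero =>
    rw [← dyadicCube_zero (fun _ => 0)]
    exact subset_iUnion (dyadicCube 0) _
  | succ n ih =>
    refine ih.trans (iUnion_subset fun k => ?_)
    rw [← iUnion_child]
    exact iUnion_subset fun l => subset_iUnion (dyadicCube (n + 1)) _

/-! ### Dyadic figures -/

lemma indicator_union_ae_eq {d : ℕ} {A B : Set (E d)} (h : volume (A ∩ B) = 0) :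
    ((A ∪ B).indicator fun _ => (1 : ℝ)) =ᵐ[volume]
      (A.indicator fun _ => (1 : ℝ)) + B.indicator fun _ => (1 : ℝ) := by
  filter_upwards [measure_eq_zero_iff_ae_notMem.1 h] with x hx
  exact indicator_union_of_notMem_inter hx _

lemma IsBVSet.integrable_indicator {d : ℕ} {A : Set (E d)} (hA : IsBVSet A) :
    Integrable (A.indicator fun _ => (1 : ℝ)) :=
  (integrableOn_const hA.bounded.measure_lt_top.ne).integrable_indicator₀ hA.measurable

lemma IsBVSet.union {d : ℕ} {A B : Set (E d)} (hA : IsBVSet A) (hB : IsBVSet B)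
    (h : volume (A ∩ B) = 0) : IsBVSet (A ∪ B) := by
  refine ⟨hA.bounded.union hB.bounded, hA.measurable.union hB.measurable, ?_⟩
  rw [perimeter, variation_congr_ae (indicator_union_ae_eq h)]
  exact (variation_add_le hA.integrable_indicator hB.integrable_indicator).trans_lt
    (ENNReal.add_lt_top.2 ⟨hA.perimeter_lt_top, hB.perimeter_lt_top⟩)

lemma isBVSet_empty {d : ℕ} : IsBVSet (∅ : Set (E d)) :=
  ⟨Bornology.isBounded_empty, nullMeasurableSet_empty, by
    rw [perimeter, indicator_empty]
    exact (variation_zero (d := d)).trans_lt ENNReal.zero_lt_top⟩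

/-- The union of a finite set of dyadic cubes of generation `n`. -/
def figure {d : ℕ} (n : ℕ) (S : Finset (Fin d → Fin (2 ^ n))) : Set (E d) :=
  ⋃ k ∈ S, dyadicCube n k

lemma figure_insert {d : ℕ} {n : ℕ} (k : Fin d → Fin (2 ^ n))
    (S : Finset (Fin d → Fin (2 ^ n))) :
    figure n (insert k S) = dyadicCube n k ∪ figure n S := by
  simp [figure]

lemma volume_dyadicCube_inter_figure {d : ℕ} {n : ℕ} {k : Fin d → Fin (2 ^ n)}
    {S : Finset (Fin d → Fin (2 ^ n))} (hk : k ∉ S) :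
    volume (dyadicCube n k ∩ figure n S) = 0 := by
  rw [figure, inter_iUnion₂]
  refine (measure_biUnion_null_iff S.countable_toSet).2 ?_
  exact fun k' hk' => volume_inter_dyadicCube fun h => hk (h ▸ hk')

lemma isBVSet_figure {d : ℕ} (n : ℕ) (S : Finset (Fin d → Fin (2 ^ n))) :
    IsBVSet (figure n S) := by
  induction S using Finset.induction_on with
  | empty => simpa [figure] using isBVSet_empty
  | insert k S hk ih =>
    rw [figure_insert]
    exact (dyadicBV n k).2.2.union ih (volume_dyadicCube_inter_figure hk)

/-- A dyadic figure as a `BV`-subset of the unit cube. -/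
def figureBV {d : ℕ} (n : ℕ) (S : Finset (Fin d → Fin (2 ^ n))) : BVSubset (unitCube d) :=
  ⟨figure n S, iUnion₂_subset fun k _ => dyadicCube_subset n k, isBVSet_figure n S⟩

lemma figure_ae_eq_gridIndex {d : ℕ} (n : ℕ) (S : Finset (Fin d → Fin (2 ^ n))) :
    figure n S =ᵐ[volume] gridIndex n ⁻¹' (toGrid '' (S : Set (Fin d → Fin (2 ^ n)))) := by
  have : (gridIndex n ⁻¹' (toGrid '' (S : Set (Fin d → Fin (2 ^ n)))) : Set (E d))
      = ⋃ k ∈ S, gridCell n (toGrid k) := by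
    ext x
    simp [gridCell, eq_comm]
  rw [this]
  exact Finset.eventuallyEq_iUnion S fun k _ => dyadicCube_ae_eq_gridCell n k

/-! ### Charges on dyadic cubes -/

lemma IsCharge.apply_figureBV {d : ℕ} {ω : BVSubset (unitCube d) → ℝ} (hω : IsCharge ω) (n : ℕ)
    (S : Finset (Fin d → Fin (2 ^ n))) : ω (figureBV n S) = ∑ k ∈ S, ω (dyadicBV n k) := by
  induction S using Finset.induction_on with
  | empty =>
    -- The empty set is almost disjoint from itself, so `ω(∅) = ω(∅) + ω(∅)`.
    have h := hω.additive (figureBV n ∅) (figureBV n ∅) (figureBV n ∅) (by simp [figureBV, figure])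
      (by simp)
    simpa using h
  | insert k S hk ih =>
    rw [Finset.sum_insert hk, ← ih]
    exact hω.additive _ _ _ (volume_dyadicCube_inter_figure hk) (figure_insert k S)

lemma IsCharge.apply_dyadicBV {d : ℕ} {ω : BVSubset (unitCube d) → ℝ} (hω : IsCharge ω) {n : ℕ}
    (k : Fin d → Fin (2 ^ n)) :
    ω (dyadicBV n k) = ∑ l, ω (dyadicBV (n + 1) (child k l)) := by
  have h : dyadicBV n k = figureBV (n + 1) (Finset.univ.image (child k)) := by
    refine Subtype.ext ?_
    simp [dyadicBV, figureBV, figure, iUnion_child]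
  rw [h, hω.apply_figureBV, Finset.sum_image (child_injective k).injOn]

lemma IsCharge.apply_unitBV {d : ℕ} {ω : BVSubset (unitCube d) → ℝ} (hω : IsCharge ω) (n : ℕ) :
    ω (unitBV d) = ∑ k, ω (dyadicBV n k) := by
  have h : unitBV d = figureBV n Finset.univ := by
    refine Subtype.ext ?_
    simp [unitBV, figureBV, figure, iUnion_dyadicCube]
  rw [h, hω.apply_figureBV]

lemma setIntegral_dyadicCube {d : ℕ} {g : E d → ℝ} (hg : IntegrableOn g (unitCube d)) {n : ℕ}
    (k : Fin d → Fin (2 ^ n)) :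
    ∫ x in dyadicCube n k, g x = ∑ l, ∫ x in dyadicCube (n + 1) (child k l), g x :=
  (isCharge_density hg).apply_dyadicBV k

lemma setIntegral_unitCube {d : ℕ} {g : E d → ℝ} (hg : IntegrableOn g (unitCube d)) (n : ℕ) :
    ∫ x in unitCube d, g x = ∑ k, ∫ x in dyadicCube n k, g x :=
  (isCharge_density hg).apply_unitBV n

/-- By additivity the values on fine cubes determine those on all coarser ones. -/
lemma IsCharge.apply_dyadicBV_congr {d : ℕ} {ω ω' : BVSubset (unitCube d) → ℝ} (hω : IsCharge ω)
    (hω' : IsCharge ω') {n : ℕ} (h : ∀ k, ω (dyadicBV n k) = ω' (dyadicBV n k)) {m : ℕ}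
    (hm : m ≤ n) (k : Fin d → Fin (2 ^ m)) : ω (dyadicBV m k) = ω' (dyadicBV m k) := by
  induction n, hm using Nat.le_induction with
  | base => exact h k
  | succ n hm ih =>
    refine ih fun k => ?_
    rw [hω.apply_dyadicBV, hω'.apply_dyadicBV]
    exact Finset.sum_congr rfl fun l _ => h _

/-! ### Cell averages -/

/-- The average of `u` over the dyadic cell of generation `n` that contains `x`. -/
def cellAverage {d : ℕ} (n : ℕ) (u : E d → ℝ) (x : E d) : ℝ :=
  ⨍ y in gridCell n (gridIndex n x), u y

/-- The constant in the Poincaré inequality for dyadic cells. -/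
def poincareConst (d : ℕ) : ℝ≥0 :=
  NNReal.sqrt d ^ (d + 1) * (volume (Metric.closedBall (0 : E d) 1)).toNNReal

lemma volume_gridCell_eq_coe {d : ℕ} (n : ℕ) (k : Fin d → ℤ) :
    volume (gridCell n k : Set (E d)) = (((2 ^ n)⁻¹ : ℝ≥0) : ℝ≥0∞) ^ d := by
  rw [volume_gridCell, ENNReal.ofReal, Real.toNNReal_of_nonneg (by positivity)]
  congr 2

/-- A cell has diameter at most `√d 2^(-n)`, so the cell of `x` lies in a ball centred at `x`;
balls, unlike cells, are translates of each other. -/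
lemma enorm_sub_cellAverage_le {d : ℕ} {u : E d → ℝ} (hi : Integrable u) (n : ℕ) (x : E d) :
    ‖u x - cellAverage n u x‖ₑ ≤ ((((2 ^ n)⁻¹ : ℝ≥0) : ℝ≥0∞) ^ d)⁻¹ *
      ∫⁻ y in Metric.closedBall x (NNReal.sqrt d * (2 ^ n)⁻¹ : ℝ≥0), ‖u y - u x‖ₑ := by
  set A : Set (E d) := gridCell n (gridIndex n x) with hA
  have hv : volume A = (((2 ^ n)⁻¹ : ℝ≥0) : ℝ≥0∞) ^ d := volume_gridCell_eq_coe n _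
  have hv0 : volume A ≠ 0 := by rw [hv]; simp
  have hvt : volume A ≠ ∞ := by
    rw [hv]
    finiteness
  have h1 : u x - cellAverage n u x = ⨍ y in A, (u x - u y) := by
    rw [setAverage_eq, integral_sub (integrable_const_iff.2 (Or.inr ⟨by simpa using hvt.lt_top⟩))
      hi.integrableOn, smul_sub,
      ← setAverage_eq, ← setAverage_eq, setAverage_const hv0 hvt]
    rfl
  have h2 : A ⊆ Metric.closedBall x (NNReal.sqrt d * (2 ^ n)⁻¹ : ℝ≥0) := fun y hy => by
    rw [Metric.mem_closedBall, dist_eq_norm]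
    simpa using norm_sub_le_of_gridIndex_eq (show gridIndex n y = gridIndex n x from hy)
  rw [h1, setAverage_eq, enorm_smul, ← hv]
  gcongr
  · rw [Measure.real, Real.enorm_eq_ofReal (by positivity),
      ENNReal.ofReal_inv_of_pos (ENNReal.toReal_pos hv0 hvt), ENNReal.ofReal_toReal hvt]
  · refine (enorm_integral_le_lintegral_enorm _).trans ?_
    simp_rw [enorm_sub_rev (u x)]
    exact lintegral_mono_set h2

lemma cellAverage_congr_ae {d : ℕ} {u w : E d → ℝ} (h : u =ᵐ[volume] w) (n : ℕ) :
    cellAverage n u = cellAverage n w := by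
  ext x
  exact setAverage_congr_fun (measurableSet_gridCell n _) (h.mono fun _ hx _ => hx)

/-- The Poincaré inequality for functions of bounded variation, summed over all dyadic cells of
generation `n`. -/
lemma lintegral_sub_cellAverage_le {d : ℕ} {u : E d → ℝ} (hi : Integrable u) (n : ℕ) :
    ∫⁻ x, ‖u x - cellAverage n u x‖ₑ
      ≤ poincareConst d * ((2 ^ n)⁻¹ : ℝ≥0) * variation u := by
  -- Both sides depend only on the class of `u`, and the exchange of integrals below needs a
  -- measurable representative.
  wlog hm : Measurable u generalizing u
  · have h := hi.1.ae_eq_mk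
    have key := this (hi.congr h) hi.1.stronglyMeasurable_mk.measurable
    rw [← variation_congr_ae h, ← cellAverage_congr_ae h n] at key
    refine (lintegral_congr_ae ?_).trans_le key
    filter_upwards [h] with x hx
    rw [← hx]
  set δ : ℝ≥0 := (2 ^ n)⁻¹ with hδ
  have hδ0 : δ ≠ 0 := by positivity
  set ρ : ℝ≥0 := NNReal.sqrt d * δ with hρ
  have hball : volume (Metric.closedBall (0 : E d) ρ)
      = (ρ : ℝ≥0∞) ^ d * volume (Metric.closedBall (0 : E d) 1) := by
    rw [Measure.addHaar_closedBall' _ _ (by positivity)]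
    simp [ENNReal.ofReal_pow]
  have h1 : volume (Metric.closedBall (0 : E d) 1)
      = ((volume (Metric.closedBall (0 : E d) 1)).toNNReal : ℝ≥0∞) :=
    (ENNReal.coe_toNNReal measure_closedBall_lt_top.ne).symm
  -- With `ρ = √d δ`, the ball has volume `ρ^d |B₁|`; dividing by the cell volume `δ^d` and
  -- multiplying by the translation length `ρ` leaves `√d^(d+1) |B₁| δ`.
  calc ∫⁻ x, ‖u x - cellAverage n u x‖ₑ
      ≤ ∫⁻ x, ((δ : ℝ≥0∞) ^ d)⁻¹ * ∫⁻ y in Metric.closedBall x ρ, ‖u y - u x‖ₑ :=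
        lintegral_mono fun x => enorm_sub_cellAverage_le hi n x
    _ = ((δ : ℝ≥0∞) ^ d)⁻¹ * ∫⁻ x, ∫⁻ y in Metric.closedBall x ρ, ‖u y - u x‖ₑ :=
        lintegral_const_mul' _ _ (by simp [hδ0])
    _ ≤ ((δ : ℝ≥0∞) ^ d)⁻¹ * (volume (Metric.closedBall (0 : E d) ρ) * ρ * variation u) := by
        gcongr
        exact lintegral_closedBall_translate_sub_le hi hm ρ
    _ = poincareConst d * δ * variation u := by
        rw [hball, h1, poincareConst, ← mul_assoc]
        congr 1
        rw [← ENNReal.coe_pow, ← ENNReal.coe_inv (by positivity)]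
        norm_cast
        rw [hρ, mul_pow]
        field_simp
        ring

/-! ### The variation of step functions -/

lemma integral_mul_comp_sub {d : ℕ} (u φ : E d → ℝ) (h : E d) :
    ∫ x, u x * φ (x - h) = ∫ x, u (x + h) * φ x := by
  rw [← integral_add_right_eq_self (fun x => u x * φ (x - h)) h]
  simp

/-- Converse to the translation estimate: the derivative of `t ↦ ∫ u(x) φ(x - t h) dx` at `0` is a
limit of difference quotients along `t = 1/(N+1)`, each bounded by an `L¹` norm. -/
lemma IsTestFun.abs_integral_fderiv_le_of_translate {d : ℕ} {φ : E d → ℝ} (hφ : IsTestFun φ)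
    {u : E d → ℝ} (hi : Integrable u) (h : E d) {B : ℝ}
    (hB : ∀ N : ℕ, (N + 1) * ∫ x, ‖u (x + ((N : ℝ) + 1)⁻¹ • h) - u x‖ ≤ B) :
    |∫ x, u x * fderiv ℝ φ x h| ≤ B := by
  have hder := hφ.hasDerivAt_integral_mul hi h 0
  have ht : Tendsto (fun N : ℕ => ((N : ℝ) + 1)⁻¹) atTop (𝓝[≠] 0) := by
    refine tendsto_nhdsWithin_iff.2 ⟨?_, Eventually.of_forall fun N => ?_⟩
    · simpa using tendsto_one_div_add_atTop_nhds_zero_nat (𝕜 := ℝ)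
    · simp only [mem_compl_iff, mem_singleton_iff]
      positivity
  have hlim := (hder.tendsto_slope.comp ht).abs
  have hder' : |∫ x, u x * fderiv ℝ φ (x - (0 : ℝ) • h) (-h)| = |∫ x, u x * fderiv ℝ φ x h| := by
    simp only [zero_smul, sub_zero, map_neg, mul_neg, integral_neg, abs_neg]
  rw [hder'] at hlim
  refine le_of_tendsto hlim (Eventually.of_forall fun N => ?_)
  refine le_trans ?_ (hB N)
  set k := ((N : ℝ) + 1)⁻¹ • h
  have hik : Integrable (fun x => u (x + k)) := hi.comp_add_right k
  have h1 : (∫ x, u x * φ (x - k)) - ∫ x, u x * φ x = ∫ x, (u (x + k) - u x) * φ x := by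
    rw [integral_mul_comp_sub, ← integral_sub (hφ.integrable_mul hik) (hφ.integrable_mul hi)]
    simp_rw [sub_mul]
  have h2 : |∫ x, (u (x + k) - u x) * φ x| ≤ ∫ x, ‖u (x + k) - u x‖ := by
    refine (norm_integral_le_integral_norm (fun x => (u (x + k) - u x) * φ x)).trans ?_
    refine integral_mono (hφ.integrable_mul (hik.sub hi)).norm (hik.sub hi).norm fun x => ?_
    simp only [norm_mul]
    exact mul_le_of_le_one_right (norm_nonneg _) (hφ.abs_le x)
  simp only [Function.comp_apply, slope_def_field, zero_smul, sub_zero]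
  rw [h1, abs_div, abs_of_pos (show (0 : ℝ) < ((N : ℝ) + 1)⁻¹ by positivity), div_inv_eq_mul,
    mul_comm]
  gcongr

/-- A monotone integer path that rises by at most one jumps at most once, so no cancellation can
occur in the telescoping sum. -/
lemma sum_abs_sub_le_of_monotone (F : ℤ → ℝ) (b : ℕ → ℤ) (hb : Monotone b) (N : ℕ)
    (hN : b N ≤ b 0 + 1) :
    ∑ j ∈ Finset.range N, |F (b (j + 1)) - F (b j)| ≤ |F (b N) - F (b 0)| := by
  have h1 : ∀ j ∈ Finset.range N, |F (b (j + 1)) - F (b j)|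
      = (b (j + 1) - b j : ℝ) * |F (b 0 + 1) - F (b 0)| := fun j hj => by
    have h0 := hb (Nat.zero_le j)
    have h1 := hb (show j ≤ j + 1 by omega)
    have h2 := hb (show j + 1 ≤ N from Finset.mem_range.1 hj)
    rcases (by omega : b j = b (j + 1) ∨ (b j = b 0 ∧ b (j + 1) = b 0 + 1)) with h | ⟨h, h'⟩
    · simp [h]
    · simp [h, h']
  rw [Finset.sum_congr rfl h1, ← Finset.sum_mul,
    Finset.sum_range_sub (fun j => (b j : ℝ))]
  rcases (by have := hb (Nat.zero_le N); omega : b N = b 0 ∨ b N = b 0 + 1) with h | h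
  · simp [h]
  · simp [h]

lemma gridIndex_add_single {d : ℕ} (n : ℕ) (x : E d) (i : Fin d) (t : ℝ) :
    gridIndex n (x + t • EuclideanSpace.single i (2 ^ n : ℝ)⁻¹)
      = Function.update (gridIndex n x) i ⌊x i * 2 ^ n + t⌋ := by
  ext j
  rcases eq_or_ne j i with rfl | hj
  · simp [gridIndex, add_mul]
  · simp [gridIndex, hj]

/-- Cut the translation by one cell width into `N + 1` equal moves. All have the same `L¹` cost, and
along each segment only one of them crosses a cell wall, so the costs add up to that of the full
move. -/
lemma step_translate_le {d : ℕ} {n : ℕ} {s : E d → ℝ} {c : (Fin d → ℤ) → ℝ}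
    (hs : ∀ x, s x = c (gridIndex n x)) (hi : Integrable s) (i : Fin d) (N : ℕ) :
    (N + 1) * ∫ x, ‖s (x + ((N : ℝ) + 1)⁻¹ • EuclideanSpace.single i (2 ^ n : ℝ)⁻¹) - s x‖
      ≤ ∫ x, ‖s (x + EuclideanSpace.single i (2 ^ n : ℝ)⁻¹) - s x‖ := by
  set h : E d := EuclideanSpace.single i (2 ^ n : ℝ)⁻¹ with hh
  set t : ℝ := ((N : ℝ) + 1)⁻¹ with ht
  have hint : ∀ a b : E d, Integrable (fun x => ‖s (x + a) - s (x + b)‖) := fun a b =>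
    ((hi.comp_add_right a).sub (hi.comp_add_right b)).norm
  have h1 : ∀ j : ℕ, ∫ x, ‖s (x + ((j + 1 : ℕ) * t) • h) - s (x + (j * t) • h)‖
      = ∫ x, ‖s (x + t • h) - s x‖ := fun j => by
    rw [← integral_add_right_eq_self (fun x => ‖s (x + t • h) - s x‖) ((j * t) • h)]
    congr! 5 with x
    push_cast
    module
  have h2 : ((N : ℝ) + 1) * ∫ x, ‖s (x + t • h) - s x‖ = ∑ j ∈ Finset.range (N + 1),
      ∫ x, ‖s (x + ((j + 1 : ℕ) * t) • h) - s (x + (j * t) • h)‖ := by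
    simp_rw [h1]
    simp
  rw [h2, ← integral_finsetSum _ fun j _ => hint _ _]
  refine integral_mono (integrable_finsetSum _ fun j _ => hint _ _)
    (by simpa using hint h 0) fun x => ?_
  have h3 := sum_abs_sub_le_of_monotone (fun b => c (Function.update (gridIndex n x) i b))
    (fun j => ⌊x i * 2 ^ n + j * t⌋) (fun j j' hj => by
      dsimp only
      gcongr) (N + 1) (by
      have : ((N + 1 : ℕ) : ℝ) * t = 1 := by
        rw [ht]
        push_cast
        field_simp
      simp only [this, Nat.cast_zero, zero_mul, add_zero]
      simp)
  have h4 : x + h = x + (((N + 1 : ℕ) : ℝ) * t) • h := by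
    have : ((N + 1 : ℕ) : ℝ) * t = 1 := by
      rw [ht]
      push_cast
      field_simp
    rw [this, one_smul]
  have h5 : s x = s (x + (((0 : ℕ) : ℝ) * t) • h) := by simp
  simp only [Real.norm_eq_abs]
  rw [h4, h5]
  simp only [hs, gridIndex_add_single, hh]
  exact h3

/-- Each component of a test field is a test function, so the directional bounds from one-cell
translations can be added; `2^n` rescales the cell width to a unit vector. -/
lemma variation_step_le {d : ℕ} {n : ℕ} {s : E d → ℝ} {c : (Fin d → ℤ) → ℝ}
    (hs : ∀ x, s x = c (gridIndex n x)) (hi : Integrable s) :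
    variation s ≤ ∑ i : Fin d,
      2 ^ n * ∫⁻ x, ‖s (x + EuclideanSpace.single i (2 ^ n : ℝ)⁻¹) - s x‖ₑ := by
  refine iSup₂_le fun v hv => ?_
  have hφ : ∀ i : Fin d, IsTestFun (fun x => v x i) := fun i => by
    refine ⟨(EuclideanSpace.proj i : E d →L[ℝ] ℝ).contDiff.comp hv.1,
      hv.2.1.comp_left (g := fun y : E d => y i) (by simp), fun x => ?_⟩
    exact (PiLp.norm_apply_le (v x) i).trans (hv.2.2 x)
  have hdiv : ∀ x, divergence v x
      = ∑ i, fderiv ℝ (fun x => v x i) x (EuclideanSpace.single i 1) := fun x => by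
    refine Finset.sum_congr rfl fun i _ => ?_
    have h1 : HasFDerivAt (fun x => v x i)
        ((EuclideanSpace.proj i : E d →L[ℝ] ℝ).comp (fderiv ℝ v x)) x :=
      (EuclideanSpace.proj i : E d →L[ℝ] ℝ).hasFDerivAt.comp x
        (hv.1.differentiable (by simp) x).hasFDerivAt
    rw [h1.fderiv]
    rfl
  have hint : ∀ i : Fin d, Integrable
      (fun x => s x * fderiv ℝ (fun x => v x i) x (EuclideanSpace.single i 1)) := fun i => by
    obtain ⟨C, hC⟩ := (hφ i).exists_norm_fderiv_le
    refine hi.mul_bdd (c := C) ?_ (ae_of_all _ fun x => ?_)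
    · have := (hφ i).continuous_fderiv
      exact Continuous.aestronglyMeasurable (by fun_prop)
    · refine (ContinuousLinearMap.le_opNorm _ _).trans ?_
      simpa using hC x
  simp_rw [hdiv, Finset.mul_sum]
  rw [integral_finsetSum _ fun i _ => hint i]
  refine (Finset.le_sum_of_subadditive ENNReal.ofReal ENNReal.ofReal_zero.le
    (fun _ _ => ENNReal.ofReal_add_le) _ _).trans (Finset.sum_le_sum fun i _ => ?_)
  set h : E d := EuclideanSpace.single i (2 ^ n : ℝ)⁻¹ with hh
  have h1 : (EuclideanSpace.single i 1 : E d) = (2 ^ n : ℝ) • h := by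
    ext j
    simp [hh]
  have h2 := (hφ i).abs_integral_fderiv_le_of_translate hi h (step_translate_le hs hi i)
  have hw : Integrable (fun x => s (x + h) - s x) := (hi.comp_add_right h).sub hi
  rw [integral_norm_eq_lintegral_enorm hw.1] at h2
  simp_rw [h1, map_smul, smul_eq_mul, mul_left_comm (s _), integral_const_mul]
  rw [ENNReal.ofReal_mul (by positivity)]
  gcongr
  · rw [ENNReal.ofReal_pow (by positivity), ENNReal.ofReal_ofNat]
  · exact (ENNReal.ofReal_le_iff_le_toReal hw.2.ne).2 ((le_abs_self _).trans h2)

/-! ### Approximation of `BV`-sets by dyadic figures -/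

/-- The dyadic cubes of generation `n` at least half of which is covered by `B`. -/
def majorityIndices {d : ℕ} (n : ℕ) (B : Set (E d)) : Finset (Fin d → Fin (2 ^ n)) :=
  open Classical in
  {k | 2⁻¹ ≤ ⨍ y in gridCell n (toGrid k), B.indicator (fun _ => (1 : ℝ)) y}

lemma indicator_majority_ae_eq {d : ℕ} (n : ℕ) {B : Set (E d)} (hB : B ⊆ unitCube d) :
    (figure n (majorityIndices n B)).indicator (fun _ => (1 : ℝ)) =ᵐ[volume]
      {x | 2⁻¹ ≤ cellAverage n (B.indicator fun _ => (1 : ℝ)) x}.indicator fun _ => (1 : ℝ) := by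
  refine indicator_ae_eq_of_ae_eq_set ((figure_ae_eq_gridIndex n _).trans ?_)
  refine EventuallyEq.of_eq (Set.ext fun x => ?_)
  -- A cell that is not one of the unit cube meets `B` in a null set, so its average is `0 < 1/2`
  -- and it is not selected.
  have h1 : (∃ k : Fin d → Fin (2 ^ n), toGrid k = gridIndex n x) ∨
      ⨍ y in gridCell n (gridIndex n x), B.indicator (fun _ => (1 : ℝ)) y = 0 := by
    refine or_iff_not_imp_left.2 fun hx => ?_
    have h2 : unitCube d =ᵐ[volume] gridIndex n ⁻¹'
        (toGrid '' (univ : Set (Fin d → Fin (2 ^ n)))) := by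
      simpa [figure, iUnion_dyadicCube] using
        figure_ae_eq_gridIndex n (Finset.univ : Finset (Fin d → Fin (2 ^ n)))
    rw [setAverage_congr_fun (g := fun _ => 0) (measurableSet_gridCell n _)]
    · simp
    · filter_upwards [h2] with y hy hyx
      refine indicator_of_notMem (fun hyB => hx ?_) _
      have h3 : y ∈ gridIndex n ⁻¹' (toGrid '' (univ : Set (Fin d → Fin (2 ^ n)))) :=
        hy.mp (hB hyB)
      obtain ⟨k, -, hk⟩ := h3
      exact ⟨k, hk.trans hyx⟩
  rcases h1 with ⟨k, hk⟩ | h1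
  · rw [mem_preimage, ← hk, toGrid_injective.mem_set_image, mem_ofPred_eq, cellAverage, ← hk]
    simp [majorityIndices]
  · rw [mem_preimage, mem_ofPred_eq, cellAverage, h1]
    refine iff_of_false ?_ (by norm_num)
    rintro ⟨k, hk, hkx⟩
    simp only [majorityIndices, Finset.coe_filter, mem_ofPred_eq, hkx, h1] at hk
    norm_num at hk

/-- Rounding an average `m` at `1/2` gives the wrong value of `u ∈ {0, 1}` only when `|u - m| ≥
1/2`; the Poincaré inequality then applies, with a factor `2`. -/
lemma lintegral_majority_sub_le {d : ℕ} (n : ℕ) {B : Set (E d)} (hB : IsBVSet B)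
    (hBc : B ⊆ unitCube d) :
    ∫⁻ x, ‖(figure n (majorityIndices n B)).indicator (fun _ => (1 : ℝ)) x
        - B.indicator (fun _ => (1 : ℝ)) x‖ₑ
      ≤ 2 * (poincareConst d * ((2 ^ n)⁻¹ : ℝ≥0) * perimeter B) := by
  set u := B.indicator fun _ => (1 : ℝ) with hu
  refine le_trans ?_ (mul_le_mul_right
    (lintegral_sub_cellAverage_le (hB.integrable_indicator) n) 2)
  rw [← lintegral_const_mul' _ _ (by simp)]
  refine lintegral_mono_ae ?_
  filter_upwards [indicator_majority_ae_eq n hBc] with x hx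
  rw [hx, ← ofReal_norm, ← ofReal_norm, ← ENNReal.ofReal_ofNat 2, ← ENNReal.ofReal_mul (by simp)]
  refine ENNReal.ofReal_le_ofReal ?_
  have h01 : u x = 0 ∨ u x = 1 := by
    by_cases h : x ∈ B <;> simp [hu, h]
  simp only [Real.norm_eq_abs]
  change _ ≤ (2 : ℝ) * |u x - cellAverage n u x|
  set m := cellAverage n u x
  by_cases hm : 2⁻¹ ≤ m
  · rw [indicator_of_mem (by exact hm)]
    rcases h01 with h | h <;> rw [h]
    · have := neg_le_abs (0 - m)
      simp only [sub_zero, abs_one]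
      linarith
    · simp
  · rw [indicator_of_notMem (by exact hm)]
    rcases h01 with h | h <;> rw [h]
    · simp
    · have := le_abs_self (1 - m)
      simp only [zero_sub, abs_neg, abs_one]
      linarith

/-- Compare the one-cell difference of the figure with that of `B`. The two approximation errors
contribute `2` Poincaré constants each and the translate of `B` contributes `1`, all times `2^(-n)`;
this cancels the `2^n` of `variation_step_le`, in each of `d` directions. -/
lemma perimeter_majority_le {d : ℕ} (n : ℕ) {B : Set (E d)} (hB : IsBVSet B)
    (hBc : B ⊆ unitCube d) :
    perimeter (figure n (majorityIndices n B)) ≤ d * (4 * poincareConst d + 1) * perimeter B := by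
  set u := B.indicator fun _ => (1 : ℝ) with hu
  set F := figure n (majorityIndices n B) with hF
  set s := {x | 2⁻¹ ≤ cellAverage n u x}.indicator fun _ => (1 : ℝ) with hs
  have hae : F.indicator (fun _ => (1 : ℝ)) =ᵐ[volume] s := indicator_majority_ae_eq n hBc
  have hsi : Integrable s := (isBVSet_figure n _).integrable_indicator.congr hae
  have hui : Integrable u := hB.integrable_indicator
  have hsu : ∫⁻ x, ‖s x - u x‖ₑ ≤ 2 * (poincareConst d * ((2 ^ n)⁻¹ : ℝ≥0) * perimeter B) := by
    refine le_trans (lintegral_congr_ae ?_).le (lintegral_majority_sub_le n hB hBc)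
    filter_upwards [hae] with x hx
    rw [← hx]
  rw [perimeter, variation_congr_ae hae]
  refine (variation_step_le (n := n) (c := fun k =>
    {k | 2⁻¹ ≤ ⨍ y in gridCell n k, u y}.indicator (fun _ => (1 : ℝ)) k) (fun x => rfl)
      hsi).trans ?_
  have h2n : (2 : ℝ≥0∞) ^ n * ((2 ^ n)⁻¹ : ℝ≥0) = 1 := by
    rw [ENNReal.coe_inv (by positivity)]
    push_cast
    exact ENNReal.mul_inv_cancel (by simp) (by simp)
  have key : ∀ i : Fin d, 2 ^ n * ∫⁻ x, ‖s (x + EuclideanSpace.single i (2 ^ n : ℝ)⁻¹) - s x‖ₑ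
      ≤ (4 * poincareConst d + 1) * perimeter B := fun i => by
    set h : E d := EuclideanSpace.single i (2 ^ n : ℝ)⁻¹ with hh
    have hn : ‖h‖ₑ = ((2 ^ n)⁻¹ : ℝ≥0) := by
      rw [hh, enorm_eq_nnnorm]
      congr 1
      ext
      simp
    have h1 : ∫⁻ x, ‖s (x + h) - s x‖ₑ
        ≤ ∫⁻ x, (‖s (x + h) - u (x + h)‖ₑ + ‖u (x + h) - u x‖ₑ + ‖s x - u x‖ₑ) := by
      refine lintegral_mono fun x => ?_
      have : s (x + h) - s x = (s (x + h) - u (x + h)) + (u (x + h) - u x) - (s x - u x) := by ring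
      rw [this]
      exact (enorm_sub_le).trans (add_le_add (enorm_add_le _ _) le_rfl)
    have hm1 : AEMeasurable fun x => ‖s x - u x‖ₑ := (hsi.sub hui).1.enorm
    have hm2 : AEMeasurable fun x => ‖u (x + h) - u x‖ₑ :=
      ((hui.comp_add_right h).sub hui).1.enorm
    rw [lintegral_add_right' _ hm1, lintegral_add_right' _ hm2,
      lintegral_add_right_eq_self (fun x => ‖s x - u x‖ₑ) h] at h1
    have h3 := lintegral_translate_sub_le hui h
    rw [hn] at h3
    calc 2 ^ n * ∫⁻ x, ‖s (x + h) - s x‖ₑ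
        ≤ 2 ^ n * (2 * (poincareConst d * ((2 ^ n)⁻¹ : ℝ≥0) * perimeter B)
          + ((2 ^ n)⁻¹ : ℝ≥0) * perimeter B
          + 2 * (poincareConst d * ((2 ^ n)⁻¹ : ℝ≥0) * perimeter B)) := by
          gcongr
          exact h1.trans (add_le_add (add_le_add hsu h3) hsu)
      _ = (2 ^ n * ((2 ^ n)⁻¹ : ℝ≥0)) * ((4 * poincareConst d + 1) * perimeter B) := by ring
      _ = _ := by rw [h2n, one_mul]
  refine (Finset.sum_le_sum fun i _ => key i).trans ?_
  simp [mul_assoc]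

lemma IsBVSet.volume_symmDiff_le {d : ℕ} {A B : Set (E d)} (hA : IsBVSet A) (hB : IsBVSet B) :
    volume (symmDiff A B)
      ≤ ∫⁻ x, ‖A.indicator (fun _ => (1 : ℝ)) x - B.indicator (fun _ => (1 : ℝ)) x‖ₑ := by
  refine meas_le_lintegral₀ (hA.integrable_indicator.sub hB.integrable_indicator).1.enorm ?_
  rintro x (⟨h, h'⟩ | ⟨h, h'⟩) <;> simp [h, h']

lemma tendsto_coe_inv_two_pow :
    Tendsto (fun n : ℕ => (((2 ^ n)⁻¹ : ℝ≥0) : ℝ≥0∞)) atTop (𝓝 0) := by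
  rw [← ENNReal.coe_zero, ENNReal.tendsto_coe]
  simp_rw [← inv_pow]
  exact tendsto_pow_atTop_nhds_zero_of_lt_one (by simp) (by
    rw [← NNReal.coe_lt_coe]
    norm_num)

/-- Every `BV`-subset of the unit cube is a limit, in the sense of `BV`-convergence, of dyadic
figures. -/
lemma bvConverges_majority {d : ℕ} (B : BVSubset (unitCube d)) :
    BVConverges (fun n => figureBV n (majorityIndices n B.1)) B := by
  have hfin := B.2.2.perimeter_lt_top
  constructor
  · refine tendsto_of_tendsto_of_tendsto_of_le_of_le (h := fun n => 2 * (poincareConst d *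
      ((2 ^ n)⁻¹ : ℝ≥0) * perimeter B.1)) tendsto_const_nhds ?_ (fun _ => bot_le) fun n =>
        ((isBVSet_figure n _).volume_symmDiff_le B.2.2).trans
          (lintegral_majority_sub_le n B.2.2 B.2.1)
    have h1 := ENNReal.Tendsto.const_mul (a := poincareConst d) tendsto_coe_inv_two_pow
      (Or.inr ENNReal.coe_ne_top)
    have h2 := ENNReal.Tendsto.mul_const (b := perimeter B.1) h1 (Or.inr hfin.ne)
    simpa using ENNReal.Tendsto.const_mul (a := 2) h2 (Or.inr (by simp))
  · refine (iSup_le fun n => perimeter_majority_le n B.2.2 B.2.1).trans_lt ?_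
    finiteness

/-- Additivity gives equality on dyadic figures, and continuity carries it to their `BV`-limits. -/
lemma IsCharge.apply_eq_of_dyadicBV {d : ℕ} {ω ω' : BVSubset (unitCube d) → ℝ} (hω : IsCharge ω)
    (hω' : IsCharge ω') (h : ∀ n k, ω (dyadicBV n k) = ω' (dyadicBV n k))
    (B : BVSubset (unitCube d)) : ω B = ω' B := by
  refine tendsto_nhds_unique (hω.continuous _ B (bvConverges_majority B)) ?_
  refine (hω'.continuous _ B (bvConverges_majority B)).congr fun n => ?_
  rw [hω.apply_figureBV, hω'.apply_figureBV]
  exact Finset.sum_congr rfl fun k _ => (h n k).symm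

/-! ### Haar functions -/

/-- The sum over `r` factors over the coordinates, which leaves the orthogonality of the columns of
a `2 × 2` matrix. -/
lemma sum_haarMatrix_mul {d : ℕ} (l l' : Fin d → Fin 2) :
    ∑ r, haarMatrix d r l * haarMatrix d r l' = if l = l' then 2 ^ d else 0 := by
  have h1 : ∀ a b : Fin 2, ∑ c, (!![1, 1; 1, -1] : Matrix (Fin 2) (Fin 2) ℝ) c a *
      (!![1, 1; 1, -1] : Matrix (Fin 2) (Fin 2) ℝ) c b = if a = b then 2 else 0 := by
    intro a b
    fin_cases a <;> fin_cases b <;> norm_num [Fin.sum_univ_two]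
  simp_rw [haarMatrix, ← Finset.prod_mul_distrib]
  rw [← Fintype.prod_sum (fun i c => (!![1, 1; 1, -1] : Matrix (Fin 2) (Fin 2) ℝ) c (l i) *
      (!![1, 1; 1, -1] : Matrix (Fin 2) (Fin 2) ℝ) c (l' i))]
  simp_rw [h1]
  split_ifs with h
  · simp [h]
  · obtain ⟨i, hi⟩ := Function.ne_iff.1 h
    exact Finset.prod_eq_zero (Finset.mem_univ i) (by simp [hi])

lemma haarMatrix_zero {d : ℕ} (l : Fin d → Fin 2) : haarMatrix d 0 l = 1 := by
  refine Finset.prod_eq_one fun i _ => ?_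
  generalize l i = a
  fin_cases a <;> simp

/-- Parseval's identity for the Haar matrix, with the constant row `r = 0` moved to the right. -/
lemma sum_haarMatrix_ne_zero {d : ℕ} (a b : (Fin d → Fin 2) → ℝ) :
    ∑ r ∈ {r : Fin d → Fin 2 | r ≠ 0},
      (∑ l, haarMatrix d r l * a l) * (∑ l, haarMatrix d r l * b l)
      = 2 ^ d * ∑ l, a l * b l - (∑ l, a l) * ∑ l, b l := by
  have h1 : ∑ r, (∑ l, haarMatrix d r l * a l) * (∑ l, haarMatrix d r l * b l)
      = 2 ^ d * ∑ l, a l * b l := by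
    simp_rw [Finset.sum_mul_sum]
    rw [Finset.sum_comm, Finset.mul_sum]
    refine Finset.sum_congr rfl fun l _ => ?_
    rw [Finset.sum_comm]
    have h2 : ∀ l', ∑ r, haarMatrix d r l * a l * (haarMatrix d r l' * b l')
        = if l = l' then 2 ^ d * (a l * b l') else 0 := fun l' => by
      have := congrArg (· * (a l * b l')) (sum_haarMatrix_mul l l')
      simp only [Finset.sum_mul, ite_mul, zero_mul] at this
      rw [← this]
      exact Finset.sum_congr rfl fun r _ => by ring
    simp_rw [h2]
    simp
  rw [← h1, Finset.filter_ne', ← Finset.add_sum_erase _ _ (Finset.mem_univ 0)]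
  simp [haarMatrix_zero]

lemma setIntegral_mul_haarFun {d : ℕ} {F : E d → ℝ} (hF : IntegrableOn F (unitCube d)) (n : ℕ)
    (k : Fin d → Fin (2 ^ n)) (r : Fin d → Fin 2) :
    ∫ x in unitCube d, F x * haarFun n k r x = (2 : ℝ) ^ ((n * d : ℝ) / 2) *
      ∑ l, haarMatrix d r l * ∫ x in dyadicCube (n + 1) (child k l), F x := by
  have h1 : ∀ x, F x * haarFun n k r x = (2 : ℝ) ^ ((n * d : ℝ) / 2) *
      ∑ l, haarMatrix d r l * (dyadicCube (n + 1) (child k l)).indicator F x := fun x => by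
    rw [haarFun, mul_left_comm, Finset.mul_sum]
    congr 1
    refine Finset.sum_congr rfl fun l _ => ?_
    by_cases hx : x ∈ dyadicCube (n + 1) (child k l) <;> simp [hx, mul_comm]
  simp_rw [h1]
  rw [integral_const_mul, integral_finsetSum _ fun l _ =>
    (hF.indicator (measurableSet_dyadicCube _ _)).const_mul _]
  congr 1
  refine Finset.sum_congr rfl fun l _ => ?_
  rw [integral_const_mul, setIntegral_indicator (measurableSet_dyadicCube _ _),
    inter_eq_self_of_subset_right (dyadicCube_subset _ _)]

/-! ### The dyadic Riemann sums of the Young integral -/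

lemma volume_dyadicCube_toReal {d : ℕ} (n : ℕ) (k : Fin d → Fin (2 ^ n)) :
    (volume (dyadicCube n k)).toReal = ((2⁻¹ : ℝ) ^ d) ^ n := by
  rw [volume_dyadicCube, ENNReal.toReal_pow, ENNReal.toReal_ofReal (by positivity), ← inv_pow,
    pow_right_comm]

lemma volume_dyadicCube_rpow {d : ℕ} (n : ℕ) (k : Fin d → Fin (2 ^ n)) (γ : ℝ) :
    (volume (dyadicCube n k)).toReal ^ γ = (((2⁻¹ : ℝ) ^ d) ^ γ) ^ n := by
  rw [volume_dyadicCube_toReal, Real.rpow_pow_comm (by positivity)]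

/-- The mean value of `F` over a dyadic cube. -/
def cubeMean {d : ℕ} (n : ℕ) (k : Fin d → Fin (2 ^ n)) (F : E d → ℝ) : ℝ :=
  (2 ^ d) ^ n * ∫ x in dyadicCube n k, F x

lemma abs_cubeMean_sub_le {d : ℕ} {n : ℕ} {k : Fin d → Fin (2 ^ n)} {F : E d → ℝ} {c ε : ℝ}
    (hF : IntegrableOn F (dyadicCube n k)) (h : ∀ x ∈ dyadicCube n k, |F x - c| ≤ ε) :
    |cubeMean n k F - c| ≤ ε := by
  have hfin : volume (dyadicCube n k) < ∞ := (dyadicBV n k).2.2.bounded.measure_lt_top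
  have h2 : ((2 : ℝ) ^ d) ^ n * ((2⁻¹ : ℝ) ^ d) ^ n = 1 := by
    rw [← mul_pow, ← mul_pow]
    simp
  have hc : c = (2 ^ d) ^ n * ∫ _x in dyadicCube n k, c := by
    rw [setIntegral_const, Measure.real, volume_dyadicCube_toReal, smul_eq_mul, ← mul_assoc, h2,
      one_mul]
  have h1 := norm_setIntegral_le_of_norm_le_const (f := fun x => F x - c) hfin h
  rw [Measure.real, volume_dyadicCube_toReal,
    integral_sub hF (integrableOn_const hfin.ne), Real.norm_eq_abs] at h1
  conv_lhs => rw [hc, cubeMean, ← mul_sub, abs_mul, abs_of_pos (by positivity)]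
  refine (mul_le_mul_of_nonneg_left h1 (by positivity)).trans_eq ?_
  rw [mul_comm ε, ← mul_assoc, h2, one_mul]

/-- The dyadic Riemann sum of generation `n` for the integral of `F` against `ω`. -/
def youngSum {d : ℕ} (ω : BVSubset (unitCube d) → ℝ) (F : E d → ℝ) (n : ℕ) : ℝ :=
  ∑ k : Fin d → Fin (2 ^ n), ω (dyadicBV n k) * cubeMean n k F

lemma youngSum_zero {d : ℕ} (ω : BVSubset (unitCube d) → ℝ) (F : E d → ℝ) :
    youngSum ω F 0 = ω (unitBV d) * ∫ x in unitCube d, F x := by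
  have : Unique (Fin d → Fin (2 ^ 0)) := inferInstanceAs (Unique (Fin d → Fin 1))
  rw [youngSum, Fintype.sum_unique, dyadicBV_zero, cubeMean, dyadicCube_zero]
  simp

lemma youngSum_succ_sub {d : ℕ} {ω : BVSubset (unitCube d) → ℝ} (hω : IsCharge ω) (F : E d → ℝ)
    (n : ℕ) : youngSum ω F (n + 1) - youngSum ω F n
      = ∑ k : Fin d → Fin (2 ^ n), ∑ l, ω (dyadicBV (n + 1) (child k l)) *
        (cubeMean (n + 1) (child k l) F - cubeMean n k F) := by
  rw [youngSum, youngSum, sum_child, ← Finset.sum_sub_distrib]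
  refine Finset.sum_congr rfl fun k _ => ?_
  rw [hω.apply_dyadicBV k, Finset.sum_mul, ← Finset.sum_sub_distrib]
  exact Finset.sum_congr rfl fun l _ => by ring

/-- Parseval on the children of each cube: the diagonal part gives the sum of generation `n + 1`,
and the missing row `r = 0` subtracts the one of generation `n`. -/
lemma sum_faberCoeff_mul_eq {d : ℕ} (ω : charge (unitCube d)) {F : E d → ℝ}
    (hF : IntegrableOn F (unitCube d)) (n : ℕ) :
    ∑ k : Fin d → Fin (2 ^ n), ∑ r ∈ {r : Fin d → Fin 2 | r ≠ 0},
      faberCoeff ω n k r * ∫ x in unitCube d, F x * haarFun n k r x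
      = youngSum ω.1 F (n + 1) - youngSum ω.1 F n := by
  rw [youngSum_succ_sub ω.2]
  refine Finset.sum_congr rfl fun k _ => ?_
  have hsq : (2 : ℝ) ^ ((n * d : ℝ) / 2) * (2 : ℝ) ^ ((n * d : ℝ) / 2) = (2 ^ d) ^ n := by
    rw [← Real.rpow_add two_pos, add_halves, ← pow_mul, mul_comm d n, ← Real.rpow_natCast]
    push_cast
    rfl
  have h1 : ∀ r, faberCoeff ω n k r * ∫ x in unitCube d, F x * haarFun n k r x
      = (2 ^ d) ^ n * ((∑ l, haarMatrix d r l * ω.1 (dyadicBV (n + 1) (child k l))) *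
        ∑ l, haarMatrix d r l * ∫ x in dyadicCube (n + 1) (child k l), F x) := fun r => by
    rw [setIntegral_mul_haarFun hF, faberCoeff, ← hsq]
    ring
  simp_rw [h1]
  rw [← Finset.mul_sum, sum_haarMatrix_ne_zero, ← setIntegral_dyadicCube hF k]
  simp_rw [mul_sub, Finset.sum_sub_distrib]
  rw [← Finset.sum_mul, cubeMean]
  -- The factor `(2^d)^n` from the two normalizations and the `2^d` from Parseval make
  -- `(2^d)^(n+1)`, the inverse volume of a child.
  congr 1
  · rw [Finset.mul_sum, Finset.mul_sum]
    refine Finset.sum_congr rfl fun l _ => ?_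
    rw [cubeMean]
    ring
  · ring

/-- The common ratio of the geometric series that control the Young integral. -/
def youngRatio (d : ℕ) (b γ : ℝ) : ℝ := 2 ^ d * ((2⁻¹ : ℝ) ^ d) ^ γ * (2⁻¹ : ℝ) ^ b

lemma youngRatio_nonneg (d : ℕ) (b γ : ℝ) : 0 ≤ youngRatio d b γ := by
  unfold youngRatio
  positivity

lemma youngRatio_lt_one {d : ℕ} {b γ : ℝ} (h : (d : ℝ) < b + d * γ) : youngRatio d b γ < 1 := by
  have h1 : youngRatio d b γ = (2 : ℝ) ^ ((d : ℝ) - d * γ - b) := by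
    rw [youngRatio, ← Real.rpow_natCast, ← Real.rpow_natCast, ← Real.rpow_mul (by norm_num),
      Real.inv_rpow two_pos.le, Real.inv_rpow two_pos.le, Real.rpow_sub two_pos,
      Real.rpow_sub two_pos]
    field_simp
  rw [h1]
  exact Real.rpow_lt_one_of_one_lt_of_neg one_lt_two (by linarith)

/-- `F` is `β`-Hölder on the unit cube with constant `L`. -/
def CubeHolder {d : ℕ} (β L : ℝ) (F : E d → ℝ) : Prop :=
  ∀ x ∈ unitCube d, ∀ y ∈ unitCube d, |F x - F y| ≤ L * ‖x - y‖ ^ β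

/-- `ω` is `γ`-Hölder on dyadic cubes with constant `κ`. -/
def ChargeHolder {d : ℕ} (γ κ : ℝ) (ω : BVSubset (unitCube d) → ℝ) : Prop :=
  ∀ (n : ℕ) (k : Fin d → Fin (2 ^ n)), |ω (dyadicBV n k)| ≤ κ * (((2⁻¹ : ℝ) ^ d) ^ γ) ^ n

lemma CubeHolder.abs_sub_cubeMean_le {d : ℕ} {β L : ℝ} (hβ : 0 ≤ β) (hL : 0 ≤ L) {F : E d → ℝ}
    (hF : CubeHolder β L F) (hi : IntegrableOn F (unitCube d)) {n : ℕ} {k : Fin d → Fin (2 ^ n)}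
    {x : E d} (hx : x ∈ dyadicCube n k) :
    |F x - cubeMean n k F| ≤ L * √d ^ β * ((2⁻¹ : ℝ) ^ β) ^ n := by
  rw [abs_sub_comm]
  refine abs_cubeMean_sub_le (hi.mono_set (dyadicCube_subset n k)) fun y hy => ?_
  refine (hF y (dyadicCube_subset n k hy) x (dyadicCube_subset n k hx)).trans ?_
  rw [Real.rpow_pow_comm (by norm_num), mul_assoc, ← Real.mul_rpow (by positivity) (by positivity),
    inv_pow]
  gcongr
  exact norm_sub_le_of_mem_dyadicCube hy hx

/-- The constant in the bound for the increments of the dyadic Riemann sums. -/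
def youngConst (d : ℕ) (β : ℝ) : ℝ := 2 ^ d * √d ^ β

lemma youngConst_nonneg (d : ℕ) (β : ℝ) : 0 ≤ youngConst d β := by
  unfold youngConst
  positivity

lemma abs_youngSum_succ_sub_le {d : ℕ} {β γ L κ : ℝ} (hβ : 0 ≤ β) (hγ : 0 ≤ γ) (hL : 0 ≤ L)
    (hκ : 0 ≤ κ) {ω : BVSubset (unitCube d) → ℝ} (hω : IsCharge ω) (hωκ : ChargeHolder γ κ ω)
    {F : E d → ℝ} (hF : CubeHolder β L F) (hi : IntegrableOn F (unitCube d)) (n : ℕ) :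
    |youngSum ω F (n + 1) - youngSum ω F n|
      ≤ youngConst d β * L * κ * youngRatio d β γ ^ n := by
  have h1 : ∀ (k : Fin d → Fin (2 ^ n)) (l : Fin d → Fin 2),
      |ω (dyadicBV (n + 1) (child k l)) * (cubeMean (n + 1) (child k l) F - cubeMean n k F)|
      ≤ (κ * (((2⁻¹ : ℝ) ^ d) ^ γ) ^ n) * (L * √d ^ β * ((2⁻¹ : ℝ) ^ β) ^ n) := fun k l => by
    have hsub : dyadicCube (n + 1) (child k l) ⊆ dyadicCube n k := by
      rw [← iUnion_child k]
      exact subset_iUnion (fun l => dyadicCube (n + 1) (child k l)) l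
    rw [abs_mul]
    gcongr
    · refine (hωκ (n + 1) (child k l)).trans ?_
      -- A child is of generation `n + 1`; the extra factor, at most one, is dropped.
      gcongr κ * ?_
      refine pow_le_pow_of_le_one (by positivity) ?_ n.le_succ
      exact Real.rpow_le_one (by positivity) (pow_le_one₀ (by norm_num) (by norm_num)) hγ
    · exact abs_cubeMean_sub_le (hi.mono_set (dyadicCube_subset _ _)) fun x hx =>
        hF.abs_sub_cubeMean_le hβ hL hi (hsub hx)
  rw [youngSum_succ_sub hω]
  refine (Finset.abs_sum_le_sum_abs _ _).trans ((Finset.sum_le_sum fun k _ =>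
    (Finset.abs_sum_le_sum_abs _ _).trans (Finset.sum_le_sum fun l _ => h1 k l)).trans_eq ?_)
  simp only [Finset.sum_const, Finset.card_univ, Fintype.card_pi, Fintype.card_fin,
    Finset.prod_const, nsmul_eq_mul, youngConst, youngRatio, mul_pow]
  push_cast
  rw [pow_right_comm 2 n d]
  ring

/-- On each cube the error is the integral of `(mean F - F) g`, and the first factor is at most the
oscillation of `F`. -/
lemma abs_youngSum_density_sub_le {d : ℕ} {β L : ℝ} (hβ : 0 ≤ β) (hL : 0 ≤ L) {F g : E d → ℝ}
    (hF : CubeHolder β L F) (hi : IntegrableOn F (unitCube d)) (hg : IntegrableOn g (unitCube d))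
    (hFg : IntegrableOn (fun x => F x * g x) (unitCube d)) (n : ℕ) :
    |youngSum (fun B : BVSubset (unitCube d) => ∫ x in B.1, g x) F n
        - ∫ x in unitCube d, F x * g x|
      ≤ L * √d ^ β * ((2⁻¹ : ℝ) ^ β) ^ n * ∫ x in unitCube d, ‖g x‖ := by
  rw [setIntegral_unitCube hFg n, setIntegral_unitCube hg.norm n, youngSum,
    ← Finset.sum_sub_distrib, Finset.mul_sum]
  refine (Finset.abs_sum_le_sum_abs _ _).trans (Finset.sum_le_sum fun k _ => ?_)
  have hgk := hg.mono_set (dyadicCube_subset n k)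
  have hFgk := hFg.mono_set (dyadicCube_subset n k)
  change |(∫ x in dyadicCube n k, g x) * _ - _| ≤ _
  rw [mul_comm, ← integral_const_mul, ← integral_sub (hgk.const_mul _) hFgk, ← integral_const_mul]
  refine (norm_integral_le_integral_norm (fun x => cubeMean n k F * g x - F x * g x)).trans ?_
  refine setIntegral_mono_on ((hgk.const_mul _).sub hFgk).norm (hgk.norm.const_mul _)
    (measurableSet_dyadicCube n k) fun x hx => ?_
  rw [← sub_mul, norm_mul, Real.norm_eq_abs, abs_sub_comm]
  gcongr
  exact hF.abs_sub_cubeMean_le hβ hL hi hx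

/-! ### Functions on the unit cube -/

/-- The extension by zero of a function on the unit cube. -/
def cubeExt {d : ℕ} (f : unitCube d → ℝ) : E d → ℝ := Function.extend Subtype.val f fun _ => 0

lemma cubeExt_coe {d : ℕ} (f : unitCube d → ℝ) (x : unitCube d) : cubeExt f x = f x :=
  Subtype.val_injective.extend_apply f _ x

lemma cubeExt_of_notMem {d : ℕ} (f : unitCube d → ℝ) {x : E d} (hx : x ∉ unitCube d) :
    cubeExt f x = 0 :=
  Function.extend_apply' f _ x fun ⟨y, hy⟩ => hx (hy ▸ y.2)

lemma cubeExt_add {d : ℕ} (f g : unitCube d → ℝ) : cubeExt (f + g) = cubeExt f + cubeExt g := by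
  ext x
  by_cases hx : x ∈ unitCube d
  · lift x to unitCube d using hx
    simp [cubeExt_coe]
  · simp [cubeExt_of_notMem _ hx]

lemma cubeExt_smul {d : ℕ} (c : ℝ) (f : unitCube d → ℝ) : cubeExt (c • f) = c • cubeExt f := by
  ext x
  by_cases hx : x ∈ unitCube d
  · lift x to unitCube d using hx
    simp [cubeExt_coe]
  · simp [cubeExt_of_notMem _ hx]

lemma integral_cubeMeasure {d : ℕ} (f : unitCube d → ℝ) :
    ∫ x, f x ∂(cubeMeasure d) = ∫ x in unitCube d, cubeExt f x := by
  rw [cubeMeasure, ← integral_subtype_comap (measurableSet_unitCube d)]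
  simp_rw [cubeExt_coe]

lemma integral_cubeMeasure_mul {d : ℕ} (f : unitCube d → ℝ) (g : E d → ℝ) :
    ∫ x, f x * g x ∂(cubeMeasure d) = ∫ x in unitCube d, cubeExt f x * g x := by
  rw [cubeMeasure, ← integral_subtype_comap (measurableSet_unitCube d)]
  simp_rw [cubeExt_coe]

lemma isCompact_unitCube (d : ℕ) : IsCompact (unitCube d) := by
  rw [unitCube_eq_box, box_eq_preimage]
  exact (PiLp.homeomorph 2 (fun _ : Fin d => ℝ)).isCompact_preimage.2 isCompact_Icc

lemma cubeHolder_of_holderWith {d : ℕ} {β C : ℝ≥0} {f : unitCube d → ℝ} (hf : HolderWith C β f) :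
    CubeHolder β C (cubeExt f) := fun x hx y hy => by
  lift x to unitCube d using hx
  lift y to unitCube d using hy
  rw [cubeExt_coe, cubeExt_coe]
  exact hf.dist_le x y

lemma continuousOn_cubeExt {d : ℕ} {β : ℝ≥0} (hβ : 0 < β) (f : holderFun d β) :
    ContinuousOn (cubeExt f.1) (unitCube d) := by
  rw [continuousOn_iff_continuous_domRestrict]
  have h : (unitCube d).domRestrict (cubeExt f.1) = f.1 := funext fun x => cubeExt_coe f.1 x
  rw [h]
  obtain ⟨C, hC⟩ := f.2
  exact hC.continuous hβ

lemma integrableOn_cubeExt {d : ℕ} {β : ℝ≥0} (hβ : 0 < β) (f : holderFun d β) :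
    IntegrableOn (cubeExt f.1) (unitCube d) :=
  (continuousOn_cubeExt hβ f).integrableOn_compact (isCompact_unitCube d)

lemma cubeHolder_cubeExt {d : ℕ} {β : ℝ≥0} (f : holderFun d β) :
    CubeHolder β (nnHolderNorm β f.1) (cubeExt f.1) :=
  cubeHolder_of_holderWith (MemHolder.holderWith f.2)

lemma abs_le_supNorm {d : ℕ} {β : ℝ≥0} (hβ : 0 < β) (f : holderFun d β)
    (x : unitCube d) : |f.1 x| ≤ supNorm f.1 := by
  obtain ⟨M, hM⟩ := (isCompact_unitCube d).exists_bound_of_continuousOn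
    (continuousOn_cubeExt hβ f)
  -- An unbounded real supremum would be `0` by default, so the bound given by compactness is
  -- essential.
  refine le_ciSup (f := fun x => |f.1 x|) ⟨M, ?_⟩ x
  rintro _ ⟨y, rfl⟩
  have := hM y y.2
  rwa [cubeExt_coe] at this

lemma chargeHolder_norm {d : ℕ} {γ : ℝ} (ω : holderCharge d γ) :
    ChargeHolder γ (holderChargeNorm ω) ω.1.1 := fun n k => by
  obtain ⟨κ, hκ, h⟩ := ω.2
  have hpos : ∀ m (k : Fin d → Fin (2 ^ m)), 0 < (volume (dyadicCube m k)).toReal ^ γ :=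
    fun m k => by
      rw [volume_dyadicCube_rpow]
      positivity
  rw [← volume_dyadicCube_rpow n k, ← div_le_iff₀ (hpos n k)]
  refine le_ciSup (f := fun K : Σ n : ℕ, (Fin d → Fin (2 ^ n)) =>
    |ω.1.1 (dyadicBV K.1 K.2)| / (volume (dyadicCube K.1 K.2)).toReal ^ γ) ⟨κ, ?_⟩ ⟨n, k⟩
  rintro _ ⟨K, rfl⟩
  exact (div_le_iff₀ (hpos K.1 K.2)).2 (h K.1 K.2)

lemma holderChargeNorm_nonneg {d : ℕ} {γ : ℝ} (ω : holderCharge d γ) : 0 ≤ holderChargeNorm ω :=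
  Real.iSup_nonneg fun K => by positivity

lemma holderChargeNorm_le {d : ℕ} {γ κ : ℝ} {ω : holderCharge d γ} (h : ChargeHolder γ κ ω.1.1) :
    holderChargeNorm ω ≤ κ := by
  have : Nonempty (Σ n : ℕ, (Fin d → Fin (2 ^ n))) := ⟨⟨0, fun _ => 0⟩⟩
  refine ciSup_le fun K => ?_
  have h1 := h K.1 K.2
  rw [volume_dyadicCube_rpow]
  rwa [div_le_iff₀ (by positivity)]

lemma mem_holderCharge {d : ℕ} {γ κ : ℝ} (hκ : 0 ≤ κ) {ω : charge (unitCube d)}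
    (h : ChargeHolder γ κ ω.1) : ω ∈ holderCharge d γ :=
  ⟨κ, hκ, fun n k => by rw [volume_dyadicCube_rpow]; exact h n k⟩

/-! ### The Young integral -/

/-- The limit of the dyadic Riemann sums. -/
def youngLim {d : ℕ} (ω : BVSubset (unitCube d) → ℝ) (F : E d → ℝ) : ℝ :=
  limUnder atTop (youngSum ω F)

lemma dist_youngSum_succ_le {d : ℕ} {β γ L κ : ℝ} (hβ : 0 ≤ β) (hγ : 0 ≤ γ) (hL : 0 ≤ L)
    (hκ : 0 ≤ κ) {ω : BVSubset (unitCube d) → ℝ} (hω : IsCharge ω)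
    (hωκ : ChargeHolder γ κ ω) {F : E d → ℝ} (hF : CubeHolder β L F)
    (hi : IntegrableOn F (unitCube d)) (n : ℕ) :
    dist (youngSum ω F n) (youngSum ω F (n + 1))
    ≤ youngConst d β * L * κ * youngRatio d β γ ^ n := by
  rw [dist_comm]
  exact abs_youngSum_succ_sub_le hβ hγ hL hκ hω hωκ hF hi n

lemma tendsto_youngSum {d : ℕ} {β γ L κ : ℝ} (hβ : 0 ≤ β) (hγ : 0 ≤ γ) (hL : 0 ≤ L)
    (hκ : 0 ≤ κ) (hβγ : (d : ℝ) < β + d * γ)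
    {ω : BVSubset (unitCube d) → ℝ} (hω : IsCharge ω)
    (hωκ : ChargeHolder γ κ ω) {F : E d → ℝ} (hF : CubeHolder β L F)
    (hi : IntegrableOn F (unitCube d)) :
    Tendsto (youngSum ω F) atTop (𝓝 (youngLim ω F)) :=
  (cauchySeq_of_le_geometric _ _ (youngRatio_lt_one hβγ)
    (dist_youngSum_succ_le hβ hγ hL hκ hω hωκ hF hi)).tendsto_limUnder

lemma dist_youngSum_youngLim_le {d : ℕ} {β γ L κ : ℝ} (hβ : 0 ≤ β) (hγ : 0 ≤ γ) (hL : 0 ≤ L)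
    (hκ : 0 ≤ κ) (hβγ : (d : ℝ) < β + d * γ)
    {ω : BVSubset (unitCube d) → ℝ} (hω : IsCharge ω)
    (hωκ : ChargeHolder γ κ ω) {F : E d → ℝ} (hF : CubeHolder β L F)
    (hi : IntegrableOn F (unitCube d)) (n : ℕ) :
    dist (youngSum ω F n) (youngLim ω F)
    ≤ youngConst d β * L * κ * youngRatio d β γ ^ n / (1 - youngRatio d β γ) :=
  dist_le_of_le_geometric_of_tendsto _ _ (youngRatio_lt_one hβγ)
    (dist_youngSum_succ_le hβ hγ hL hκ hω hωκ hF hi)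
    (tendsto_youngSum hβ hγ hL hκ hβγ hω hωκ hF hi) n

lemma hasSum_youngSum_sub {d : ℕ} {β γ L κ : ℝ} (hβ : 0 ≤ β) (hγ : 0 ≤ γ) (hL : 0 ≤ L)
    (hκ : 0 ≤ κ) (hβγ : (d : ℝ) < β + d * γ)
    {ω : BVSubset (unitCube d) → ℝ} (hω : IsCharge ω)
    (hωκ : ChargeHolder γ κ ω) {F : E d → ℝ} (hF : CubeHolder β L F)
    (hi : IntegrableOn F (unitCube d)) :
    HasSum (fun n => youngSum ω F (n + 1) - youngSum ω F n)
    (youngLim ω F - youngSum ω F 0) := by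
  have hs : Summable fun n => youngSum ω F (n + 1) - youngSum ω F n :=
    Summable.of_norm_bounded ((summable_geometric_of_lt_one (youngRatio_nonneg d β γ)
      (youngRatio_lt_one hβγ)).mul_left _)
      (abs_youngSum_succ_sub_le hβ hγ hL hκ hω hωκ hF hi)
  rw [hs.hasSum_iff_tendsto_nat]
  simp_rw [Finset.sum_range_sub (youngSum ω F)]
  exact (tendsto_youngSum hβ hγ hL hκ hβγ hω hωκ hF hi).sub_const _

lemma tendsto_youngSum_cubeExt {d : ℕ} {β : ℝ≥0} {γ : ℝ} (hβ : 0 < β) (hγ : 0 ≤ γ)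
    (hβγ : (d : ℝ) < β + d * γ) (f : holderFun d β) (ω : holderCharge d γ) :
    Tendsto (youngSum ω.1.1 (cubeExt f.1)) atTop (𝓝 (youngLim ω.1.1 (cubeExt f.1))) :=
  tendsto_youngSum β.2 hγ (NNReal.coe_nonneg _) (holderChargeNorm_nonneg ω) hβγ ω.1.2
    (chargeHolder_norm ω) (cubeHolder_cubeExt f) (integrableOn_cubeExt hβ f)

lemma cubeMean_add {d n : ℕ} (k : Fin d → Fin (2 ^ n)) {F G : E d → ℝ}
    (hF : IntegrableOn F (unitCube d)) (hG : IntegrableOn G (unitCube d)) :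
    cubeMean n k (F + G) = cubeMean n k F + cubeMean n k G := by
  simp only [cubeMean, Pi.add_apply]
  rw [integral_add (hF.mono_set (dyadicCube_subset n k)) (hG.mono_set (dyadicCube_subset n k)),
    mul_add]

lemma cubeMean_smul {d n : ℕ} (k : Fin d → Fin (2 ^ n)) (c : ℝ) (F : E d → ℝ) :
    cubeMean n k (c • F) = c * cubeMean n k F := by
  simp only [cubeMean, Pi.smul_apply, smul_eq_mul, integral_const_mul]
  ring

/-- The Young integral, as a bilinear map. -/
def youngIntegral {d : ℕ} {β : ℝ≥0} {γ : ℝ} (hβ : 0 < β) (hγ : 0 ≤ γ)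
    (hβγ : (d : ℝ) < β + d * γ) : holderFun d β →ₗ[ℝ] holderCharge d γ →ₗ[ℝ] ℝ :=
  LinearMap.mk₂ ℝ (fun f ω => youngLim ω.1.1 (cubeExt f.1))
    (fun f f' ω => by
      refine tendsto_nhds_unique (tendsto_youngSum_cubeExt hβ hγ hβγ (f + f') ω) ?_
      refine ((tendsto_youngSum_cubeExt hβ hγ hβγ f ω).add
        (tendsto_youngSum_cubeExt hβ hγ hβγ f' ω)).congr
        fun n => ?_
      simp only [youngSum, ← Finset.sum_add_distrib, ← mul_add]
      refine Finset.sum_congr rfl fun k _ => ?_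
      rw [← cubeMean_add k (integrableOn_cubeExt hβ f) (integrableOn_cubeExt hβ f'), ← cubeExt_add]
      rfl)
    (fun c f ω => by
      refine tendsto_nhds_unique (tendsto_youngSum_cubeExt hβ hγ hβγ (c • f) ω) ?_
      refine ((tendsto_youngSum_cubeExt hβ hγ hβγ f ω).const_mul c).congr fun n => ?_
      simp only [youngSum, Finset.mul_sum, mul_left_comm c]
      refine Finset.sum_congr rfl fun k _ => ?_
      rw [← cubeMean_smul, ← cubeExt_smul]
      rfl)
    (fun f ω ω' => by
      refine tendsto_nhds_unique (tendsto_youngSum_cubeExt hβ hγ hβγ f (ω + ω')) ?_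
      refine ((tendsto_youngSum_cubeExt hβ hγ hβγ f ω).add
        (tendsto_youngSum_cubeExt hβ hγ hβγ f ω')).congr
        fun n => ?_
      simp only [youngSum, ← Finset.sum_add_distrib, ← add_mul]
      rfl)
    (fun c f ω => by
      refine tendsto_nhds_unique (tendsto_youngSum_cubeExt hβ hγ hβγ f (c • ω)) ?_
      refine ((tendsto_youngSum_cubeExt hβ hγ hβγ f ω).const_mul c).congr fun n => ?_
      simp only [youngSum, Finset.mul_sum, ← mul_assoc]
      rfl)

lemma youngIntegral_apply {d : ℕ} {β : ℝ≥0} {γ : ℝ} (hβ : 0 < β) (hγ : 0 ≤ γ)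
    (hβγ : (d : ℝ) < β + d * γ) (f : holderFun d β) (ω : holderCharge d γ) :
    youngIntegral hβ hγ hβγ f ω = youngLim ω.1.1 (cubeExt f.1) := rfl

lemma hasSum_youngIntegral {d : ℕ} {β : ℝ≥0} {γ : ℝ} (hβ : 0 < β) (hγ : 0 ≤ γ)
    (hβγ : (d : ℝ) < β + d * γ) (f : holderFun d β) (ω : holderCharge d γ) :
    HasSum (fun n : ℕ => ∑ k : Fin d → Fin (2 ^ n), ∑ r ∈ {r : Fin d → Fin 2 | r ≠ 0},
        faberCoeff ω.1 n k r * ∫ x, f.1 x * haarFun n k r x ∂(cubeMeasure d))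
      (youngIntegral hβ hγ hβγ f ω - ω.1.1 (unitBV d) * ∫ x, f.1 x ∂(cubeMeasure d)) := by
  have h := hasSum_youngSum_sub β.2 hγ (NNReal.coe_nonneg _) (holderChargeNorm_nonneg ω) hβγ ω.1.2
    (chargeHolder_norm ω) (cubeHolder_cubeExt f) (integrableOn_cubeExt hβ f)
  rw [youngSum_zero, ← integral_cubeMeasure] at h
  simp_rw [integral_cubeMeasure_mul, sum_faberCoeff_mul_eq ω.1 (integrableOn_cubeExt hβ f)]
  exact h

/-- The sum of generation `0` accounts for `‖f‖_∞ ‖ω‖_γ`, and the geometric series of increments for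
the rest. -/
lemma abs_youngIntegral_le {d : ℕ} {β : ℝ≥0} {γ : ℝ} (hβ : 0 < β) (hγ : 0 ≤ γ)
    (hβγ : (d : ℝ) < β + d * γ) (f : holderFun d β) (ω : holderCharge d γ) :
    |youngIntegral hβ hγ hβγ f ω| ≤ (1 + youngConst d β / (1 - youngRatio d β γ)) *
      (supNorm f.1 + nnHolderNorm β f.1) * holderChargeNorm ω := by
  set L : ℝ := (nnHolderNorm β f.1 : ℝ)
  set κ := holderChargeNorm ω
  set S := supNorm f.1
  set A := youngConst d β / (1 - youngRatio d β γ)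
  have hL : 0 ≤ L := NNReal.coe_nonneg _
  have hκ : 0 ≤ κ := holderChargeNorm_nonneg ω
  have hA : 0 ≤ A := div_nonneg (youngConst_nonneg d β) (by linarith [youngRatio_lt_one hβγ])
  have hS : 0 ≤ S := Real.iSup_nonneg fun x => abs_nonneg _
  have h1 := dist_youngSum_youngLim_le β.2 hγ hL hκ hβγ ω.1.2 (chargeHolder_norm ω)
    (cubeHolder_cubeExt f)
    (integrableOn_cubeExt hβ f) 0
  have h2 : |youngSum ω.1.1 (cubeExt f.1) 0| ≤ κ * S := by
    have : Unique (Fin d → Fin (2 ^ 0)) := inferInstanceAs (Unique (Fin d → Fin 1))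
    obtain ⟨k, hk⟩ : ∃ k, youngSum ω.1.1 (cubeExt f.1) 0
        = ω.1.1 (dyadicBV 0 k) * cubeMean 0 k (cubeExt f.1) := ⟨_, Fintype.sum_unique _⟩
    rw [hk, abs_mul]
    have h3 := chargeHolder_norm ω 0 k
    simp only [pow_zero, mul_one] at h3
    refine mul_le_mul h3 ?_ (abs_nonneg _) hκ
    have h4 := abs_cubeMean_sub_le (n := 0) (k := k) (c := 0) (ε := S)
      ((integrableOn_cubeExt hβ f).mono_set (dyadicCube_subset 0 k)) fun x hx => by
        have h5 := dyadicCube_subset 0 k hx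
        lift x to unitCube d using h5
        rw [cubeExt_coe, sub_zero]
        exact abs_le_supNorm hβ f x
    rwa [sub_zero] at h4
  rw [youngIntegral_apply]
  have h3 : |youngLim ω.1.1 (cubeExt f.1)| ≤ κ * S + A * (L * κ) := by
    rw [dist_comm, Real.dist_eq, pow_zero, mul_one] at h1
    have h4 := abs_add_le (youngLim ω.1.1 (cubeExt f.1) - youngSum ω.1.1 (cubeExt f.1) 0)
      (youngSum ω.1.1 (cubeExt f.1) 0)
    rw [sub_add_cancel] at h4
    have h5 : youngConst d β * L * κ / (1 - youngRatio d β γ) = A * (L * κ) := by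
      simp only [A]
      ring
    exact h4.trans (by linarith [h1.trans_eq h5])
  refine h3.trans ?_
  have h6 : 0 ≤ A * (S * κ) := by positivity
  have h7 : 0 ≤ L * κ := by positivity
  nlinarith

lemma agreesWithLebesgue_youngIntegral {d : ℕ} {β : ℝ≥0} {γ : ℝ} (hβ : 0 < β) (hγ0 : 0 < γ)
    (hγ1 : γ < 1) (hβγ : (d : ℝ) < β + d * γ) :
    AgreesWithLebesgue hγ0 hγ1 (youngIntegral (d := d) hβ hγ0.le hβγ) := by
  intro f g hg
  rw [integral_cubeMeasure_mul]
  have hgi := MemLp.integrableOn_cube hγ0 hγ1 hg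
  have hfg : IntegrableOn (fun x => cubeExt f.1 x * g x) (unitCube d) := by
    obtain ⟨M, hM⟩ := (isCompact_unitCube d).exists_bound_of_continuousOn (continuousOn_cubeExt hβ f)
    exact Integrable.bdd_mul hgi (integrableOn_cubeExt hβ f).1
      ((ae_restrict_mem (measurableSet_unitCube d)).mono hM)
  refine tendsto_nhds_unique
    (tendsto_youngSum_cubeExt hβ hγ0.le hβγ f (densityCharge hγ0 hγ1 g hg)) ?_
  rw [tendsto_iff_dist_tendsto_zero]
  refine squeeze_zero (fun _ => dist_nonneg) (fun n => abs_youngSum_density_sub_le β.2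
    (NNReal.coe_nonneg _) (cubeHolder_cubeExt f) (integrableOn_cubeExt hβ f) hgi hfg n) ?_
  have h1 : Tendsto (fun n => ((2⁻¹ : ℝ) ^ (β : ℝ)) ^ n) atTop (𝓝 0) :=
    tendsto_pow_atTop_nhds_zero_of_lt_one (by positivity)
      (Real.rpow_lt_one (by norm_num) (by norm_num) (by exact_mod_cast hβ))
  simpa using (h1.const_mul _).mul_const _

/-! ### Sequential continuity -/

/-- The `+ 1` rules out `∞ · 0`: the inequality then holds even if `ω` is not strong and the
indicator of `B` has norm zero. -/
lemma enorm_apply_le_strongNorm {d : ℕ} {A : Set (E d)} (ω : charge A) (B : BVSubset A) :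
    ‖ω.1 B‖ₑ ≤ strongNorm ω * (‖BVSubset.ind B‖ₑ + 1) := by
  rw [← ENNReal.div_le_iff (by simp) (by finiteness)]
  refine le_iInf₂ fun α hα => ENNReal.div_le_of_le_mul ?_
  rw [hα.2 B]
  refine (α.le_opENorm _).trans ?_
  gcongr
  exact le_self_add

lemma tendsto_apply_of_strongNorm {d : ℕ} {A : Set (E d)} {ω : ℕ → charge A} {ω' : charge A}
    (h : Tendsto (fun p => strongNorm (ω p - ω')) atTop (𝓝 0)) (B : BVSubset A) :
    Tendsto (fun p => (ω p).1 B) atTop (𝓝 (ω'.1 B)) := by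
  rw [tendsto_iff_edist_tendsto_0]
  have h1 := ENNReal.Tendsto.mul_const (b := ‖BVSubset.ind B‖ₑ + 1) h (Or.inr (by finiteness))
  rw [zero_mul] at h1
  refine tendsto_of_tendsto_of_tendsto_of_le_of_le tendsto_const_nhds h1 (fun _ => bot_le)
    fun p => ?_
  rw [edist_eq_enorm_sub]
  exact enorm_apply_le_strongNorm (ω p - ω') B

lemma tendsto_cubeMean {d : ℕ} {β : ℝ≥0} (hβ : 0 < β) {f : ℕ → holderFun d β} {f' : holderFun d β}
    (h : TendstoUniformly (fun p => (f p).1) f'.1 atTop) {n : ℕ} (k : Fin d → Fin (2 ^ n)) :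
    Tendsto (fun p => cubeMean n k (cubeExt (f p).1)) atTop (𝓝 (cubeMean n k (cubeExt f'.1))) := by
  rw [Metric.tendsto_nhds]
  intro ε hε
  filter_upwards [Metric.tendstoUniformly_iff.1 h (ε / 2) (half_pos hε)] with p hp
  have h1 : cubeMean n k (cubeExt (f p).1) - cubeMean n k (cubeExt f'.1)
      = cubeMean n k (cubeExt (f p - f').1) := by
    rw [sub_eq_iff_eq_add, ← cubeMean_add k (integrableOn_cubeExt hβ (f p - f'))
      (integrableOn_cubeExt hβ f'),
      ← cubeExt_add]
    simp
  rw [Real.dist_eq, h1]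
  refine lt_of_le_of_lt ?_ (half_lt_self hε)
  have h2 := abs_cubeMean_sub_le (k := k) (c := 0) (ε := ε / 2)
    ((integrableOn_cubeExt hβ (f p - f')).mono_set (dyadicCube_subset n k)) fun x hx => by
      have hx' := dyadicCube_subset n k hx
      lift x to unitCube d using hx'
      rw [cubeExt_coe, sub_zero]
      have := (hp x).le
      rw [dist_comm] at this
      exact this
  rwa [sub_zero] at h2

/-- Hölder bounds survive pointwise limits. Convergence is then a three-`ε` argument: one generation
`n` approximates every integral of the sequence and the limit, and its finite sum converges. -/
lemma isSeqContinuous_youngIntegral {d : ℕ} {β : ℝ≥0} {γ : ℝ} (hβ : 0 < β) (hγ : 0 ≤ γ)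
    (hβγ : (d : ℝ) < β + d * γ) : IsSeqContinuous (youngIntegral (d := d) hβ hγ hβγ) := by
  intro f f' ω ω' hff' hfb _ hωω' hωb
  obtain ⟨L, hL⟩ := hfb
  obtain ⟨κ, hκ⟩ := hωb
  have hL' : ∀ p, HolderWith L β (f p).1 := fun p x y => by
    refine (MemHolder.holderWith (f p).2 x y).trans ?_
    gcongr
    exact hL (mem_range_self p)
  have hκ' : ∀ p, ChargeHolder γ κ (ω p).1.1 := fun p n k => by
    refine (chargeHolder_norm (ω p) n k).trans ?_
    gcongr
    exact hκ (mem_range_self p)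
  have hκ0 : 0 ≤ κ := (holderChargeNorm_nonneg (ω 0)).trans (hκ (mem_range_self 0))
  have hfL : HolderWith L β f' := fun x y =>
    le_of_tendsto ((hff'.tendsto_at x).edist (hff'.tendsto_at y))
      (Eventually.of_forall fun p => hL' p x y)
  have hωt := tendsto_apply_of_strongNorm hωω'
  have hωκ : ChargeHolder γ κ ω'.1 := fun n k =>
    le_of_tendsto (hωt (dyadicBV n k)).abs (Eventually.of_forall fun p => hκ' p n k)
  refine ⟨⟨L, hfL⟩, mem_holderCharge hκ0 hωκ, ?_⟩
  set f₀ : holderFun d β := ⟨f', ⟨L, hfL⟩⟩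
  have hsum : ∀ n, Tendsto (fun p => youngSum (ω p).1.1 (cubeExt (f p).1) n) atTop
      (𝓝 (youngSum ω'.1 (cubeExt f') n)) := fun n =>
    tendsto_finsetSum _ fun k _ => (hωt (dyadicBV n k)).mul (tendsto_cubeMean (f' := f₀) hβ hff' k)
  set q := youngRatio d β γ with hq
  have hb0 : Tendsto (fun n => youngConst d β * L * κ * q ^ n / (1 - q)) atTop (𝓝 0) := by
    have h1 := tendsto_pow_atTop_nhds_zero_of_lt_one (youngRatio_nonneg d β γ)
      (youngRatio_lt_one hβγ)
    simpa using (h1.const_mul (youngConst d β * L * κ)).div_const (1 - q)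
  rw [Metric.tendsto_nhds]
  intro ε hε
  obtain ⟨n, hn⟩ := (hb0.eventually_lt_const (show 0 < ε / 3 by positivity)).exists
  filter_upwards [Metric.tendsto_nhds.1 (hsum n) (ε / 3) (by positivity)] with p hp
  have h1 := dist_youngSum_youngLim_le β.2 hγ (NNReal.coe_nonneg L) hκ0 hβγ (ω p).1.2 (hκ' p)
    (cubeHolder_of_holderWith (hL' p)) (integrableOn_cubeExt hβ (f p)) n
  have h2 := dist_youngSum_youngLim_le β.2 hγ (NNReal.coe_nonneg L) hκ0 hβγ ω'.2 hωκ
    (cubeHolder_of_holderWith hfL) (integrableOn_cubeExt hβ f₀) n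
  rw [youngIntegral_apply, youngIntegral_apply]
  replace h1 := h1.trans_lt hn
  replace h2 := h2.trans_lt hn
  have h3 := dist_triangle4 (youngLim (ω p).1.1 (cubeExt (f p).1))
    (youngSum (ω p).1.1 (cubeExt (f p).1) n) (youngSum ω'.1 (cubeExt f') n)
    (youngLim ω'.1 (cubeExt f'))
  rw [dist_comm] at h1
  change dist (youngLim (ω p).1.1 (cubeExt (f p).1)) (youngLim ω'.1 (cubeExt f')) < ε
  exact h3.trans_lt (by linarith)

/-! ### Dyadic step densities of a charge -/

/-- The density, constant on dyadic cells of generation `n`, of the charge that agrees with `ω` on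
the dyadic cubes of generation `n`. -/
def stepDensity {d : ℕ} (ω : BVSubset (unitCube d) → ℝ) (n : ℕ) (x : E d) : ℝ :=
  Function.extend toGrid (fun k => ω (dyadicBV n k) * (2 ^ d) ^ n) (fun _ => 0) (gridIndex n x)

lemma measurable_comp_gridIndex {d : ℕ} (c : (Fin d → ℤ) → ℝ) (n : ℕ) :
    Measurable fun x : E d => c (gridIndex n x) :=
  (Measurable.of_discrete (f := c)).comp (measurable_gridIndex n)

lemma measurable_stepDensity {d : ℕ} (ω : BVSubset (unitCube d) → ℝ) (n : ℕ) :
    Measurable (stepDensity ω n) := measurable_comp_gridIndex _ n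

lemma abs_stepDensity_le {d : ℕ} {γ κ : ℝ} (hκ : 0 ≤ κ) {ω : BVSubset (unitCube d) → ℝ}
    (hω : ChargeHolder γ κ ω) (n : ℕ) (x : E d) :
    |stepDensity ω n x| ≤ κ * (2 ^ d * ((2⁻¹ : ℝ) ^ d) ^ γ) ^ n := by
  by_cases h : ∃ k : Fin d → Fin (2 ^ n), toGrid k = gridIndex n x
  · obtain ⟨k, hk⟩ := h
    rw [stepDensity, ← hk, toGrid_injective.extend_apply, abs_mul,
      abs_of_nonneg (show (0 : ℝ) ≤ (2 ^ d) ^ n by positivity), mul_pow, mul_comm (((2 : ℝ) ^ d) ^ n),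
      ← mul_assoc]
    gcongr
    exact hω n k
  · rw [stepDensity, Function.extend_apply' _ _ _ h, abs_zero]
    positivity

lemma setIntegral_dyadicCube_of_gridIndex {d n : ℕ} (k : Fin d → Fin (2 ^ n)) {F G : E d → ℝ}
    (h : ∀ x, gridIndex n x = toGrid k → F x = G x) :
    ∫ x in dyadicCube n k, F x = ∫ x in dyadicCube n k, G x := by
  rw [setIntegral_congr_set (dyadicCube_ae_eq_gridCell n k),
    setIntegral_congr_set (dyadicCube_ae_eq_gridCell n k)]
  exact setIntegral_congr_fun (measurableSet_gridCell n _) fun x hx => h x hx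

lemma setIntegral_stepDensity {d : ℕ} (ω : BVSubset (unitCube d) → ℝ) (n : ℕ)
    (k : Fin d → Fin (2 ^ n)) : ∫ x in dyadicCube n k, stepDensity ω n x = ω (dyadicBV n k) := by
  rw [setIntegral_dyadicCube_of_gridIndex k (G := fun _ => ω (dyadicBV n k) * (2 ^ d) ^ n)
    fun x hx => by rw [stepDensity, hx, toGrid_injective.extend_apply], setIntegral_const,
    Measure.real, volume_dyadicCube_toReal, smul_eq_mul, mul_left_comm, ← mul_pow, ← mul_pow]
  simp

instance isFiniteMeasure_restrict_unitCube (d : ℕ) :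
    IsFiniteMeasure (volume.restrict (unitCube d)) :=
  ⟨by
    rw [Measure.restrict_apply_univ]
    exact (isCompact_unitCube d).measure_lt_top⟩

lemma memLp_unitCube_of_bound {d : ℕ} {g : E d → ℝ} (hg : Measurable g) {C : ℝ}
    (hC : ∀ x, |g x| ≤ C) (p : ℝ≥0∞) : MemLp g p (volume.restrict (unitCube d)) :=
  MemLp.of_bound hg.aestronglyMeasurable C (ae_of_all _ hC)

lemma setIntegral_stepDensity_of_le {d : ℕ} {γ κ : ℝ} (hκ : 0 ≤ κ)
    {ω : BVSubset (unitCube d) → ℝ} (hω : IsCharge ω) (hωκ : ChargeHolder γ κ ω) {m n : ℕ}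
    (hmn : m ≤ n) (k : Fin d → Fin (2 ^ m)) :
    ∫ x in dyadicCube m k, stepDensity ω n x = ω (dyadicBV m k) :=
  (isCharge_density (memLp_one_iff_integrable.1 (memLp_unitCube_of_bound
    (measurable_stepDensity ω n) (abs_stepDensity_le hκ hωκ n) 1))).apply_dyadicBV_congr hω
    (setIntegral_stepDensity ω n) hmn k

/-- Keeps the Hölder norms of the approximants bounded, as (B) demands. Up to generation `n` the
charge agrees with `ω`; on smaller cubes it is proportional to volume, which decays at least as fast
as its power `γ`. -/
lemma chargeHolder_stepDensity {d : ℕ} {γ κ : ℝ} (hγ1 : γ ≤ 1) (hκ : 0 ≤ κ)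
    {ω : BVSubset (unitCube d) → ℝ} (hω : IsCharge ω) (hωκ : ChargeHolder γ κ ω) (n : ℕ) :
    ChargeHolder γ κ (fun B : BVSubset (unitCube d) => ∫ x in B.1, stepDensity ω n x) := by
  intro m k
  change |∫ x in dyadicCube m k, stepDensity ω n x| ≤ _
  rcases le_total m n with hmn | hmn
  · rw [setIntegral_stepDensity_of_le hκ hω hωκ hmn]
    exact hωκ m k
  · have h1 := norm_setIntegral_le_of_norm_le_const (μ := volume) (s := dyadicCube m k)
      (dyadicBV m k).2.2.bounded.measure_lt_top
      (f := stepDensity ω n) fun x _ => abs_stepDensity_le hκ hωκ n x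
    refine h1.trans ?_
    rw [Measure.real, volume_dyadicCube_toReal]
    obtain ⟨j, rfl⟩ := Nat.exists_eq_add_of_le hmn
    set a : ℝ := (2⁻¹ : ℝ) ^ d with ha
    have ha0 : 0 < a := by positivity
    have hab : a ≤ a ^ γ := by
      conv_lhs => rw [← Real.rpow_one a]
      exact Real.rpow_le_rpow_of_exponent_ge ha0 (pow_le_one₀ (by norm_num) (by norm_num)) hγ1
    have h2a : (2 : ℝ) ^ d * a = 1 := by
      rw [ha, ← mul_pow]
      simp
    calc κ * (2 ^ d * a ^ γ) ^ n * a ^ (n + j)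
        = κ * (2 ^ d * a) ^ n * (a ^ γ) ^ n * a ^ j := by ring
      _ ≤ κ * (2 ^ d * a) ^ n * (a ^ γ) ^ n * (a ^ γ) ^ j := by gcongr
      _ = κ * (a ^ γ) ^ (n + j) := by rw [h2a]; ring

/-! ### Strong charges -/

lemma BV.integral_norm_le {d : ℕ} (hd : 1 ≤ d) (u : BV (unitCube d)) :
    ∫ x, ‖u.toFun x‖ ≤ 2 * ‖u‖ := by
  have hu := u.mem
  rw [integral_norm_eq_lintegral_enorm hu.1.1, BV.norm_def]
  have h := ENNReal.toReal_mono (by finiteness [hu.2.1.ne])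
    (lintegral_enorm_le_variation hd hu.1 hu.2.2)
  simpa using h

/-- The functional `u ↦ ∫ g u` on `BV([0, 1]^d)`, for a bounded function `g`. -/
def densityFunctional {d : ℕ} (hd : 1 ≤ d) {g : E d → ℝ} (hg : Measurable g) {C : ℝ}
    (hC : ∀ x, |g x| ≤ C) : StrongDual ℝ (BV (unitCube d)) :=
  have hint : ∀ u : BV (unitCube d),
      Integrable (fun x => g x * u.toFun x) (volume.restrict (unitCube d)) := fun u =>
    Integrable.bdd_mul u.mem.1.integrableOn hg.aestronglyMeasurable (ae_of_all _ hC)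
  LinearMap.mkContinuous
    { toFun := fun u => ∫ x in unitCube d, g x * u.toFun x
      map_add' := fun u w => by
        rw [← integral_add (hint u) (hint w)]
        simp [mul_add]
      map_smul' := fun c u => by
        rw [RingHom.id_apply, smul_eq_mul, ← integral_const_mul]
        simp [mul_left_comm] }
    (C * 2) fun u => by
      have hC0 : 0 ≤ C := (abs_nonneg _).trans (hC 0)
      refine (norm_integral_le_integral_norm _).trans ?_
      refine (integral_mono (hint u).norm (u.mem.1.integrableOn.norm.const_mul C) fun x => ?_).trans
        ?_
      · simp only [norm_mul]
        gcongr
        exact hC x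
      · rw [integral_const_mul, mul_assoc]
        gcongr
        exact (setIntegral_le_integral u.mem.1.norm (ae_of_all _ fun _ => norm_nonneg _)).trans
          (BV.integral_norm_le hd u)

lemma densityFunctional_apply {d : ℕ} (hd : 1 ≤ d) {g : E d → ℝ} (hg : Measurable g) {C : ℝ}
    (hC : ∀ x, |g x| ≤ C) (u : BV (unitCube d)) :
    densityFunctional hd hg hC u = ∫ x in unitCube d, g x * u.toFun x := rfl

lemma densityFunctional_sub {d : ℕ} (hd : 1 ≤ d) {g g' : E d → ℝ} (hg : Measurable g)
    (hg' : Measurable g') {C C' : ℝ} (hC : ∀ x, |g x| ≤ C) (hC' : ∀ x, |g' x| ≤ C') :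
    densityFunctional hd hg hC - densityFunctional hd hg' hC'
      = densityFunctional hd (hg.sub hg') (C := C + C')
        fun x => (abs_sub _ _).trans (add_le_add (hC x) (hC' x)) := by
  ext u
  rw [sub_apply, densityFunctional_apply, densityFunctional_apply,
    densityFunctional_apply, ← integral_sub]
  · simp [sub_mul]
  · exact Integrable.bdd_mul u.mem.1.integrableOn hg.aestronglyMeasurable (ae_of_all _ hC)
  · exact Integrable.bdd_mul u.mem.1.integrableOn hg'.aestronglyMeasurable (ae_of_all _ hC')

lemma densityFunctional_mem {d : ℕ} (hd : 1 ≤ d) {g : E d → ℝ} (hg : Measurable g) {C : ℝ}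
    (hC : ∀ x, |g x| ≤ C) : densityFunctional hd hg hC ∈ strongFunctional (unitCube d) :=
  subset_closure ⟨g, memLp_unitCube_of_bound hg hC d, fun _ => rfl⟩

lemma setIntegral_mul_ind {d : ℕ} {A : Set (E d)} (g : E d → ℝ) (B : BVSubset A) :
    ∫ x in A, g x * (BVSubset.ind B).toFun x = ∫ x in B.1, g x := by
  have hnm : NullMeasurableSet B.1 (volume.restrict A) :=
    B.2.2.measurable.mono_ac Measure.restrict_le_self.absolutelyContinuous
  have h1 : ∀ x, g x * (BVSubset.ind B).toFun x = B.1.indicator g x := fun x => by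
    rw [BVSubset.toFun_ind]
    by_cases hx : x ∈ B.1 <;> simp [hx]
  simp_rw [h1]
  rw [integral_indicator₀ hnm, Measure.restrict_restrict₀ hnm, inter_eq_self_of_subset_left B.2.1]

/-- Along a `BV`-convergent sequence the indicators are bounded in `BV`, so approximation in the
dual norm is uniform on them and continuity passes from densities to the limit. -/
lemma isCharge_of_mem_strongFunctional {d : ℕ} (hd : 1 ≤ d) {α : StrongDual ℝ (BV (unitCube d))}
    (hα : α ∈ strongFunctional (unitCube d)) :
    IsCharge fun B : BVSubset (unitCube d) => α (BVSubset.ind B) := by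
  obtain ⟨a, ha, haα⟩ := mem_closure_iff_seq_limit.1 hα
  have hc : ∀ n, IsCharge fun B : BVSubset (unitCube d) => a n (BVSubset.ind B) := fun n => by
    obtain ⟨g, hg, h⟩ := ha n
    have hgi : IntegrableOn g (unitCube d) := hg.integrable (by exact_mod_cast hd)
    have := isCharge_density hgi
    simp_rw [h, setIntegral_mul_ind]
    exact this
  have hlim : ∀ u, Tendsto (fun n => a n u) atTop (𝓝 (α u)) := fun u =>
    ((ContinuousLinearMap.apply ℝ ℝ u).continuous.tendsto α).comp haα
  refine ⟨fun B₁ B₂ B h h' => ?_, fun B B' h => ?_⟩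
  · refine tendsto_nhds_unique (hlim _) (((hlim _).add (hlim _)).congr fun n => ?_)
    exact ((hc n).additive B₁ B₂ B h h').symm
  · set P := (⨆ n, perimeter (B n).1).toReal + ‖BVSubset.ind B'‖ + 1 with hP
    have hP0 : 0 < P := by positivity
    have hBn : ∀ n, ‖BVSubset.ind (B n)‖ ≤ P := fun n => by
      have h1 : ‖BVSubset.ind (B n)‖ ≤ (⨆ n, perimeter (B n).1).toReal :=
        ENNReal.toReal_mono h.2.ne (le_iSup (fun n => perimeter (B n).1) n)
      have h2 := norm_nonneg (BVSubset.ind B')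
      linarith
    have hB' : ‖BVSubset.ind B'‖ ≤ P := by
      have h2 : 0 ≤ (⨆ n, perimeter (B n).1).toReal := ENNReal.toReal_nonneg
      linarith
    rw [Metric.tendsto_nhds]
    intro ε hε
    obtain ⟨j, hj⟩ := (Metric.tendsto_nhds.1 haα (ε / (3 * P)) (by positivity)).exists
    have hju : ∀ u : BV (unitCube d), ‖u‖ ≤ P → dist (a j u) (α u) < ε / 3 := fun u hu => by
      rw [dist_eq_norm] at hj ⊢
      rw [← sub_apply]
      calc ‖(a j - α) u‖ ≤ ‖a j - α‖ * ‖u‖ := ContinuousLinearMap.le_opNorm _ _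
        _ ≤ ‖a j - α‖ * P := by gcongr
        _ < ε / (3 * P) * P := by gcongr
        _ = ε / 3 := by field_simp
    filter_upwards [Metric.tendsto_nhds.1 ((hc j).continuous B B' h) (ε / 3) (by positivity)]
      with n hn
    have h1 := hju _ (hBn n)
    have h2 := hju _ hB'
    rw [dist_comm] at h1
    have h3 := dist_triangle4 (α (BVSubset.ind (B n))) (a j (BVSubset.ind (B n)))
      (a j (BVSubset.ind B')) (α (BVSubset.ind B'))
    exact h3.trans_lt (by linarith)

/-- As `ψ` has mean zero on the cubes, `u` may be replaced by `u` minus its cell averages; the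
Poincaré inequality then gains `2^(-n)`. -/
lemma abs_setIntegral_mul_le {d : ℕ} {u : E d → ℝ} (hu : Integrable u) (hv : variation u < ∞)
    {n : ℕ} {ψ : E d → ℝ} (hψ : Measurable ψ) {M : ℝ} (hM : ∀ x, |ψ x| ≤ M)
    (h0 : ∀ k, ∫ x in dyadicCube n k, ψ x = 0) :
    |∫ x in unitCube d, ψ x * u x|
      ≤ M * (poincareConst d * (2⁻¹ : ℝ) ^ n * (variation u).toReal) := by
  have hM0 : 0 ≤ M := (abs_nonneg _).trans (hM 0)
  have hP := lintegral_sub_cellAverage_le hu n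
  have hPfin : poincareConst d * ((2 ^ n)⁻¹ : ℝ≥0) * variation u ≠ ∞ := by finiteness
  set m := cellAverage n u with hm
  have hmm : Measurable m :=
    measurable_comp_gridIndex (fun k => ⨍ y in gridCell n k, u y) n
  have hum : Integrable (fun x => u x - m x) :=
    ⟨hu.1.sub hmm.aestronglyMeasurable, hP.trans_lt hPfin.lt_top⟩
  have hi1 : IntegrableOn (fun x => ψ x * u x) (unitCube d) :=
    Integrable.bdd_mul hu.integrableOn hψ.aestronglyMeasurable (ae_of_all _ hM)
  have hi2 : IntegrableOn (fun x => ψ x * (u x - m x)) (unitCube d) :=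
    Integrable.bdd_mul hum.integrableOn hψ.aestronglyMeasurable (ae_of_all _ hM)
  have hi3 : IntegrableOn (fun x => ψ x * m x) (unitCube d) := by
    refine (hi1.sub hi2).congr (ae_of_all _ fun x => ?_)
    simp only [Pi.sub_apply]
    ring
  have h1 : ∫ x in unitCube d, ψ x * m x = 0 := by
    rw [setIntegral_unitCube hi3 n]
    refine Finset.sum_eq_zero fun k _ => ?_
    rw [setIntegral_dyadicCube_of_gridIndex k
      (G := fun x => ψ x * ⨍ y in gridCell n (toGrid k), u y)
      fun x hx => by rw [hm, cellAverage, hx], integral_mul_const, h0, zero_mul]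
  have h2 : ∫ x in unitCube d, ψ x * u x = ∫ x in unitCube d, ψ x * (u x - m x) := by
    rw [← sub_eq_zero, ← integral_sub hi1 hi2, ← h1]
    congr! 2 with x
    ring
  have h3 : ∫ x, ‖u x - m x‖ ≤ poincareConst d * (2⁻¹ : ℝ) ^ n * (variation u).toReal := by
    rw [integral_norm_eq_lintegral_enorm hum.1]
    refine (ENNReal.toReal_mono hPfin hP).trans_eq ?_
    simp [ENNReal.toReal_mul]
  rw [h2]
  refine (norm_integral_le_integral_norm (fun x => ψ x * (u x - m x))).trans ?_
  refine (integral_mono hi2.norm (hum.integrableOn.norm.const_mul M) fun x => ?_).trans ?_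
  · simp only [norm_mul]
    gcongr
    exact hM x
  · rw [integral_const_mul]
    gcongr
    exact (setIntegral_le_integral hum.norm (ae_of_all _ fun _ => norm_nonneg _)).trans h3

/-- The functional associated with the dyadic step density of a Hölder charge. -/
def stepFunctional {d : ℕ} (hd : 1 ≤ d) {γ κ : ℝ} (hκ : 0 ≤ κ) {ω : BVSubset (unitCube d) → ℝ}
    (hω : ChargeHolder γ κ ω) (n : ℕ) : StrongDual ℝ (BV (unitCube d)) :=
  densityFunctional hd (measurable_stepDensity ω n) (abs_stepDensity_le hκ hω n)

lemma stepFunctional_ind {d : ℕ} (hd : 1 ≤ d) {γ κ : ℝ} (hκ : 0 ≤ κ)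
    {ω : BVSubset (unitCube d) → ℝ} (hω : ChargeHolder γ κ ω) (n : ℕ)
    (B : BVSubset (unitCube d)) :
    stepFunctional hd hκ hω n (BVSubset.ind B) = ∫ x in B.1, stepDensity ω n x :=
  setIntegral_mul_ind _ B

/-- Consecutive densities have equal integrals on cubes of generation `n`. The Poincaré gain
`2^(-n)` plays the role of a Hölder exponent `1`, hence the ratio with `b = 1`. -/
lemma dist_stepFunctional_le {d : ℕ} (hd : 1 ≤ d) {γ κ : ℝ} (hγ : 0 ≤ γ) (hκ : 0 ≤ κ)
    {ω : BVSubset (unitCube d) → ℝ} (hω : IsCharge ω) (hωκ : ChargeHolder γ κ ω) (n : ℕ) :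
    dist (stepFunctional hd hκ hωκ n) (stepFunctional hd hκ hωκ (n + 1))
      ≤ κ * (2 ^ d + 1) * poincareConst d * youngRatio d 1 γ ^ n := by
  rw [dist_comm, dist_eq_norm, stepFunctional, stepFunctional, densityFunctional_sub]
  refine ContinuousLinearMap.opNorm_le_bound _ ?_ fun u => ?_
  · have := youngRatio_nonneg d 1 γ
    positivity
  rw [densityFunctional_apply, BV.norm_def]
  set b : ℝ := ((2⁻¹ : ℝ) ^ d) ^ γ with hb
  have hb0 : 0 ≤ b := by positivity
  have hb1 : b ≤ 1 := Real.rpow_le_one (by positivity) (pow_le_one₀ (by norm_num) (by norm_num)) hγ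
  have hψ : ∀ x, |(stepDensity ω (n + 1) - stepDensity ω n) x| ≤ κ * (2 ^ d + 1) * (2 ^ d * b) ^ n :=
    fun x => by
      refine (abs_sub _ _).trans ((add_le_add (abs_stepDensity_le hκ hωκ (n + 1) x)
        (abs_stepDensity_le hκ hωκ n x)).trans ?_)
      rw [← hb, pow_succ]
      have h1 : (2 : ℝ) ^ d * b ≤ 2 ^ d := mul_le_of_le_one_right (by positivity) hb1
      calc κ * ((2 ^ d * b) ^ n * (2 ^ d * b)) + κ * (2 ^ d * b) ^ n
          ≤ κ * ((2 ^ d * b) ^ n * 2 ^ d) + κ * (2 ^ d * b) ^ n := by gcongr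
        _ = _ := by ring
  have hint : ∀ j, IntegrableOn (stepDensity ω j) (unitCube d) := fun j =>
    memLp_one_iff_integrable.1 (memLp_unitCube_of_bound (measurable_stepDensity ω j)
      (abs_stepDensity_le hκ hωκ j) 1)
  refine (abs_setIntegral_mul_le u.mem.1 u.mem.2.1 (n := n)
    ((measurable_stepDensity ω (n + 1)).sub (measurable_stepDensity ω n)) hψ fun k => ?_).trans_eq ?_
  · simp only [Pi.sub_apply]
    rw [integral_sub ((hint _).mono_set (dyadicCube_subset n k))
      ((hint _).mono_set (dyadicCube_subset n k)),
      setIntegral_stepDensity_of_le hκ hω hωκ n.le_succ, setIntegral_stepDensity, sub_self]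
  · rw [youngRatio, Real.rpow_one, mul_pow _ (2⁻¹ : ℝ)]
    ring

/-- The approximation of a Hölder charge by charges with dyadic step densities. -/
def stepCharge {d : ℕ} {γ : ℝ} (h0 : 0 < γ) (h1 : γ < 1) (ω : holderCharge d γ) (n : ℕ) :
    holderCharge d γ :=
  densityCharge h0 h1 (stepDensity ω.1.1 n) (memLp_unitCube_of_bound (measurable_stepDensity _ n)
    (abs_stepDensity_le (holderChargeNorm_nonneg ω) (chargeHolder_norm ω) n) _)

/-- Hölder charges are strong, and limits of charges with step densities. -/
lemma exists_represents {d : ℕ} (hd : 1 ≤ d) {γ : ℝ} (h0 : 0 < γ)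
    (hdγ : (d : ℝ) < 1 + d * γ) (ω : holderCharge d γ) :
    ∃ α, Represents α ω.1.1 ∧ Tendsto (stepFunctional hd (holderChargeNorm_nonneg ω)
      (chargeHolder_norm ω)) atTop (𝓝 α) := by
  have hκ := holderChargeNorm_nonneg ω
  have hωκ := chargeHolder_norm ω
  obtain ⟨α, hα⟩ := cauchySeq_tendsto_of_complete (cauchySeq_of_le_geometric _ _
    (youngRatio_lt_one hdγ) (dist_stepFunctional_le hd h0.le hκ ω.1.2 hωκ))
  have hαs : α ∈ strongFunctional (unitCube d) :=
    isClosed_closure.mem_of_tendsto hα (Eventually.of_forall fun n => densityFunctional_mem _ _ _)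
  refine ⟨α, ⟨hαs, ω.1.2.apply_eq_of_dyadicBV (isCharge_of_mem_strongFunctional hd hαs)
    fun m k => ?_⟩, hα⟩
  have h2 : Tendsto (fun n => stepFunctional hd hκ hωκ n (BVSubset.ind (dyadicBV m k))) atTop
      (𝓝 (α (BVSubset.ind (dyadicBV m k)))) :=
    ((ContinuousLinearMap.apply ℝ ℝ (BVSubset.ind (dyadicBV m k))).continuous.tendsto α).comp hα
  refine tendsto_nhds_unique (tendsto_const_nhds.congr' ?_) h2
  -- On a fixed dyadic cube the approximants equal `ω` as soon as `n ≥ m`.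
  filter_upwards [eventually_ge_atTop m] with n hn
  rw [stepFunctional_ind]
  exact (setIntegral_stepDensity_of_le hκ ω.1.2 hωκ hn k).symm

lemma tendsto_strongNorm_stepCharge {d : ℕ} (hd : 1 ≤ d) {γ : ℝ} (h0 : 0 < γ) (h1 : γ < 1)
    (hdγ : (d : ℝ) < 1 + d * γ) (ω : holderCharge d γ) :
    Tendsto (fun n => strongNorm ((stepCharge h0 h1 ω n).1 - ω.1)) atTop (𝓝 0) := by
  obtain ⟨α, hα, hlim⟩ := exists_represents hd h0 hdγ ω
  set a := stepFunctional hd (holderChargeNorm_nonneg ω) (chargeHolder_norm ω) with ha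
  have hrep : ∀ n, Represents (a n - α) ((stepCharge h0 h1 ω n).1 - ω.1).1 := fun n => by
    -- The difference `a n - α` is the limit of the differences `a n - a m`, which are themselves
    -- given by bounded densities.
    refine ⟨isClosed_closure.mem_of_tendsto (tendsto_const_nhds.sub hlim)
      (Eventually.of_forall fun m => ?_), fun B => ?_⟩
    · rw [ha, stepFunctional, stepFunctional, densityFunctional_sub]
      exact densityFunctional_mem _ _ _
    · rw [sub_apply, ← hα.2 B, ha, stepFunctional_ind]
      rfl
  refine tendsto_of_tendsto_of_tendsto_of_le_of_le tendsto_const_nhds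
    (tendsto_iff_edist_tendsto_0.1 hlim) (fun _ => bot_le) fun n => ?_
  rw [edist_eq_enorm_sub]
  exact iInf₂_le (a n - α) (hrep n)

/-- The Young integral is determined by its values on charges with a density. -/
lemma youngIntegral_unique {d : ℕ} (hd : 1 ≤ d) {β : ℝ≥0} {γ : ℝ} (h0 : 0 < γ) (h1 : γ < 1)
    (hdγ : (d : ℝ) < 1 + d * γ) {I J : holderFun d β →ₗ[ℝ] holderCharge d γ →ₗ[ℝ] ℝ}
    (hI : AgreesWithLebesgue h0 h1 I) (hI' : IsSeqContinuous I)
    (hJ : AgreesWithLebesgue h0 h1 J) (hJ' : IsSeqContinuous J) : J = I := by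
  refine LinearMap.ext fun f => LinearMap.ext fun ω => ?_
  have key : ∀ H : holderFun d β →ₗ[ℝ] holderCharge d γ →ₗ[ℝ] ℝ, IsSeqContinuous H →
      Tendsto (fun n => H f (stepCharge h0 h1 ω n)) atTop (𝓝 (H f ω)) := fun H hH => by
    obtain ⟨α, hα, -⟩ := exists_represents hd h0 hdγ ω
    obtain ⟨_, _, h⟩ := hH (fun _ => f) f.1 (stepCharge h0 h1 ω) ω.1
      (fun _ hu => Eventually.of_forall fun _ _ => refl_mem_uniformity hu)
      ⟨_, by rintro _ ⟨_, rfl⟩; exact le_rfl⟩ ⟨α, hα⟩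
      (tendsto_strongNorm_stepCharge hd h0 h1 hdγ ω) ⟨holderChargeNorm ω, by
        rintro _ ⟨n, rfl⟩
        exact holderChargeNorm_le (chargeHolder_stepDensity h1.le (holderChargeNorm_nonneg ω)
          ω.1.2 (chargeHolder_norm ω) n)⟩
    exact h
  refine tendsto_nhds_unique (key J hJ') ((key I hI').congr fun n => ?_)
  rw [stepCharge, hI, hJ]

end YoungCharge

end

/-! ### Existence, uniqueness, series and bound for the Young integral -/

theorem mainTheorem1 (d : ℕ) (hd : 1 ≤ d) (β : ℝ≥0) (γ : ℝ) (hβ0 : 0 < β) (hβ1 : β < 1)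
    (hγ0 : 0 < γ) (hγ1 : γ < 1) (hβγ : (d : ℝ) < β + d * γ) :
    ∃ I : holderFun d β →ₗ[ℝ] holderCharge d γ →ₗ[ℝ] ℝ,
      (AgreesWithLebesgue hγ0 hγ1 I ∧ IsSeqContinuous I) ∧
      (∀ J : holderFun d β →ₗ[ℝ] holderCharge d γ →ₗ[ℝ] ℝ,
        AgreesWithLebesgue hγ0 hγ1 J ∧ IsSeqContinuous J → J = I) ∧
      (∀ (f : holderFun d β) (ω : holderCharge d γ),
        HasSum
          (fun n : ℕ => ∑ k : Fin d → Fin (2 ^ n), ∑ r ∈ {r : Fin d → Fin 2 | r ≠ 0},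
            faberCoeff ω.1 n k r * ∫ x, f.1 x * haarFun n k r x ∂(cubeMeasure d))
          (I f ω - ω.1.1 (unitBV d) * ∫ x, f.1 x ∂(cubeMeasure d))) ∧
      ∃ C : ℝ, 0 ≤ C ∧ ∀ (f : holderFun d β) (ω : holderCharge d γ),
        |I f ω| ≤ C * (supNorm f.1 + nnHolderNorm β f.1) * holderChargeNorm ω := by
  -- This weaker condition makes Hölder charges strong, on which uniqueness rests.
  have hdγ : (d : ℝ) < 1 + d * γ := hβγ.trans_le (by gcongr; exact_mod_cast hβ1.le)
  refine ⟨youngIntegral hβ0 hγ0.le hβγ,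
    ⟨agreesWithLebesgue_youngIntegral hβ0 hγ0 hγ1 hβγ,
      isSeqContinuous_youngIntegral hβ0 hγ0.le hβγ⟩,
    fun J hJ => youngIntegral_unique hd hγ0 hγ1 hdγ
      (agreesWithLebesgue_youngIntegral hβ0 hγ0 hγ1 hβγ)
      (isSeqContinuous_youngIntegral hβ0 hγ0.le hβγ) hJ.1 hJ.2,
    hasSum_youngIntegral hβ0 hγ0.le hβγ, 1 + youngConst d β / (1 - youngRatio d β γ), ?_,
    abs_youngIntegral_le hβ0 hγ0.le hβγ⟩
  have h1 := youngConst_nonneg d β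
  have h2 : 0 < 1 - youngRatio d β γ := sub_pos.2 (youngRatio_lt_one hβγ)
  positivity
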